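/- Let $\mathbf X$, $\mathbf E$, $\mathbf F$ be complex Banach spaces with injective continuous embeddings with dense range $\mathbf E\overset{\imath}{\hookrightarrow}\mathbf X\overset{\jmath}{\hookrightarrow}\mathbf F$. Let $A$ be a closed densely defined linear operator in $\mathbf X$ such that the operator $\Psi\mapsto\jmath(A\jmath^{-1}\Psi)$ with domain $\jmath(\mathfrak D(A))$ is closable in $\mathbf F$, and let $\hat A$ be its closure. Let $\Omega\subset\mathbb C\setminus\sigma(A)$ be open and connected, and let $z_0\in\sigma_{\mathrm{ess}}(A)\cap\partial\Omega$. Here $\sigma_{\mathrm{ess}}(A)$ is the spectrum of $A$ without those of its isolated points $z$ for which $A-zI$ is Fredholm. A linear operator $\check B:\mathbf F\supset\mathfrak D(\check B)\to\mathbf E$ is called $\hat A$-compact if $\mathfrak D(\hat A)\subset\mathfrak D(\check B)$ and $\check B$ maps the unit ball of $\mathfrak D(\hat A)$ in the graph norm $\|\Psi\|_{\mathbf F}+\|\hat A\Psi\|_{\mathbf F}$ into a precompact subset of $\mathbf E$. For such $\check B$ put $B=\imath\circ\check B\circ\jmath$. Let $\mathscr Q$ be the set of all closed $\hat A$-compact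 operators $\check B$ from $\mathbf F$ to $\mathbf E$ such that $\Omega\cap\sigma_{\mathrm{ess}}(A+B)=\varnothing$, such that $\Omega\cap\sigma(A+B)\cap\{z:|z-z_0|<\delta\}=\varnothing$ for some $\delta>0$, and for which the limit $$(A+B-z_0I)^{-1}_{\Omega}:=\operatorname*{w-lim}_{z\to z_0,\ z\in\Omega}\ \jmath\circ(A+B-zI)^{-1}\circ\imath:\ \mathbf E\to\mathbf F$$ exists in the weak operator topology of bounded operators $\mathbf E\to\mathbf F$. Assume that $\mathscr Q\neq\varnothing$. For $\check B\in\mathscr Q$ define the space of virtual states $$\mathfrak M=\{\Psi\in\operatorname{Range}\big((A+B-z_0I)^{-1}_{\Omega}\big):\ \Psi\in\mathfrak D(\hat A),\ (\hat A-z_0I)\Psi=0\}\subset\mathbf F,$$ and the operator $K=\check B\,(A+B-z_0I)^{-1}_{\Omega}$ in $\mathbf E$. For an operator $T$, let $\mathfrak L(T)$ denote its generalized null space: the set of all $\psi$ such that $T^i\psi$ is defined and lies in $\mathfrak D(T)$ for every $i\ge 0$ and $T^k\psi=0$ for some $k$. The rank of an operator is the dimension of its range. Then: 1. $\mathfrak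 M$ does not depend on the choice of $\check B\in\mathscr Q$. 2. $\jmath\big(\imath(\mathbf E)\cap\ker(A-z_0I)\big)\subset\mathfrak M$. 3. For every $\check B\in\mathscr Q$ the operator $K$ is defined on all of $\mathbf E$. The minimal rank $r:=\min\{\operatorname{rank}\check B:\check B\in\mathscr Q\}$ is finite, and for every $\check B\in\mathscr Q$ one has $\dim\mathfrak M=r\le\dim\mathfrak L(I_{\mathbf E}-K)$. 4. If $\check B\in\mathscr Q$ has rank $r$, then $\ker(I_{\mathbf E}-K)=\mathfrak L(I_{\mathbf E}-K)$. -/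

import Mathlib

open Topology Filter

namespace VirtualLevels

section Operators

variable {V W G : Type*}
  [NormedAddCommGroup V] [NormedSpace ℂ V]
  [NormedAddCommGroup W] [NormedSpace ℂ W]
  [NormedAddCommGroup G] [NormedSpace ℂ G]

/-- The composition `T ∘ R` of a partially defined operator `T` with an everywhere defined
bounded operator `R`; its domain is `{x | R x ∈ 𝔇(T)}`. -/
def compCLM (T : W →ₗ.[ℂ] G) (R : V →L[ℂ] W) : V →ₗ.[ℂ] G where
  domain := T.domain.comap (R : V →ₗ[ℂ] W)
  toFun := T.toFun ∘ₗ (R : V →ₗ[ℂ] W).submoduleComap T.domain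

/-- `A - z I`, with domain `𝔇(A)`. -/
def subScalar (A : V →ₗ.[ℂ] V) (z : ℂ) : V →ₗ.[ℂ] V where
  domain := A.domain
  toFun := A.toFun - z • A.domain.subtype

/-- `I - K`, with domain `𝔇(K)`. -/
def oneSub (K : V →ₗ.[ℂ] V) : V →ₗ.[ℂ] V where
  domain := K.domain
  toFun := K.domain.subtype - K.toFun

/-- The null space `{ψ ∈ 𝔇(T) | T ψ = 0}`. -/
def nullSpace (T : V →ₗ.[ℂ] W) : Submodule ℂ V :=
  (LinearMap.ker T.toFun).map T.domain.subtype

/-- The rank of an operator: the dimension of its range. -/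
noncomputable def opRank (T : V →ₗ.[ℂ] W) : Cardinal :=
  Module.rank ℂ (LinearMap.range T.toFun)

/-- The root lineal (generalized null space) of `T`: the vectors `ψ` all of whose iterates
`s i = T ^ i ψ` are defined and belong to `𝔇(T)`, and for which `T ^ k ψ = 0` for some `k`. -/
def rootLineal (T : V →ₗ.[ℂ] V) : Submodule ℂ V where
  carrier := {ψ | ∃ s : ℕ → T.domain, (s 0 : V) = ψ ∧ (∀ i, T (s i) = (s (i + 1) : V)) ∧
    ∃ k, s k = 0}
  zero_mem' := ⟨fun _ => 0, by simp, fun _ => by simp, 0, rfl⟩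
  smul_mem' := by
    rintro c ψ ⟨s, h0, hs, k, hk⟩
    exact ⟨fun i => c • s i, by simp [h0], fun i => by simp [LinearPMap.map_smul, hs], k,
      by simp [hk]⟩
  add_mem' := by
    have key : ∀ s : ℕ → T.domain, (∀ i, T (s i) = (s (i + 1) : V)) → ∀ k, s k = 0 →
        ∀ m, s (k + m) = 0 := by
      intro s hs k hk m
      induction m with
      | zero => exact hk
      | succ m ih =>
        apply Subtype.ext
        rw [← add_assoc, ← hs, ih]
        simp
    rintro ψ θ ⟨s, h0, hs, k, hk⟩ ⟨t, g0, ht, l, hl⟩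
    refine ⟨fun i => s i + t i, by simp [h0, g0],
      fun i => by simp [LinearPMap.map_add, hs, ht], k + l, ?_⟩
    have h1 := key s hs k hk l
    have h2 := key t ht l hl k
    rw [add_comm] at h2
    simp [h1, h2]

/-- `R` is a bounded everywhere defined two-sided inverse of `T : 𝔇(T) → V`. -/
def IsBoundedInverse (T : V →ₗ.[ℂ] V) (R : V →L[ℂ] V) : Prop :=
  (∀ u : T.domain, R (T u) = u) ∧ ∀ x : V, ∃ u : T.domain, (u : V) = R x ∧ T u = x

/-- The spectrum `σ(A)` of a partially defined operator. -/
def spec (A : V →ₗ.[ℂ] V) : Set ℂ :=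
  {z | ¬ ∃ R : V →L[ℂ] V, IsBoundedInverse (subScalar A z) R}

open Classical in
/-- The resolvent `(A - z I)⁻¹` for `z ∉ σ(A)` (and `0` for `z ∈ σ(A)`). -/
noncomputable def resolv (A : V →ₗ.[ℂ] V) (z : ℂ) : V →L[ℂ] V :=
  if h : ∃ R : V →L[ℂ] V, IsBoundedInverse (subScalar A z) R then h.choose else 0

/-- Fredholm operators: finite-dimensional null space and closed range of finite codimension. -/
def IsFredholmOp (T : V →ₗ.[ℂ] W) : Prop :=
  FiniteDimensional ℂ (LinearMap.ker T.toFun) ∧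
  IsClosed (LinearMap.range T.toFun : Set W) ∧
  FiniteDimensional ℂ (W ⧸ LinearMap.range T.toFun)

/-- The discrete spectrum: isolated points `z` of `σ(A)` for which `A - z I` is Fredholm. -/
def discreteSpec (A : V →ₗ.[ℂ] V) : Set ℂ :=
  {z | z ∈ spec A ∧ (∀ᶠ w in 𝓝[≠] z, w ∉ spec A) ∧ IsFredholmOp (subScalar A z)}

/-- The essential spectrum `σ_ess(A) = σ(A) \ σ_d(A)`. -/
def essSpec (A : V →ₗ.[ℂ] V) : Set ℂ := spec A \ discreteSpec A

/-- `B` is `T`-compact: `𝔇(T) ⊆ 𝔇(B)`, and `B` maps the unit ball of the graph norm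
`‖ψ‖ + ‖T ψ‖` on `𝔇(T)` into a precompact set. -/
def RelCompact (T : V →ₗ.[ℂ] V) (B : V →ₗ.[ℂ] W) : Prop :=
  ∃ h : T.domain ≤ B.domain,
    IsCompact (closure {y : W | ∃ ψ : T.domain, ‖(ψ : V)‖ + ‖T ψ‖ < 1 ∧
      B (Submodule.inclusion h ψ) = y})

/-- The operator `Ψ ↦ j (A (j⁻¹ Ψ))` in `W` with domain `j (𝔇(A))`. -/
noncomputable def transfer (j : V →L[ℂ] W) (hj : Function.Injective j) (A : V →ₗ.[ℂ] V) :
    W →ₗ.[ℂ] W where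
  domain := A.domain.map (j : V →ₗ[ℂ] W)
  toFun := (j : V →ₗ[ℂ] W) ∘ₗ A.toFun ∘ₗ
    (Submodule.equivMapOfInjective (j : V →ₗ[ℂ] W) hj A.domain).symm.toLinearMap

/-- `Â`: the closure in `W` of `A` considered as an operator `W → W`. -/
noncomputable def hat (j : V →L[ℂ] W) (hj : Function.Injective j) (A : V →ₗ.[ℂ] V) :
    W →ₗ.[ℂ] W :=
  (transfer j hj A).closure

end Operators

section States

variable {E X F : Type*}
  [NormedAddCommGroup E] [NormedSpace ℂ E]
  [NormedAddCommGroup X] [NormedSpace ℂ X]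
  [NormedAddCommGroup F] [NormedSpace ℂ F]

/-- `A + B` with `B = ι ∘ B̌ ∘ j`; its domain is `{x ∈ 𝔇(A) | j x ∈ 𝔇(B̌)}`. -/
def perturbed (ι : E →L[ℂ] X) (j : X →L[ℂ] F) (A : X →ₗ.[ℂ] X) (B : F →ₗ.[ℂ] E) :
    X →ₗ.[ℂ] X :=
  A + (ι : E →ₗ[ℂ] X).compPMap (compCLM B j)

/-- `j ∘ (T - z I)⁻¹ ∘ ι : E → F`, as a point of the space of bounded operators with the weak
operator topology. -/
noncomputable def resolvEF (ι : E →L[ℂ] X) (j : X →L[ℂ] F) (T : X →ₗ.[ℂ] X) (z : ℂ) :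
    E →WOT[ℂ] F :=
  ContinuousLinearMapWOT.ofCLM (j ∘L resolv T z ∘L ι)

/-- The set `𝒬` of regularizing perturbations: the closed `Â`-compact operators `B̌ : F → E`
such that `Ω ∩ σ_ess(A + B) = ∅`, `σ(A + B)` does not meet `Ω` near `z₀`, and
`j ∘ (A + B - z I)⁻¹ ∘ ι` converges in the weak operator topology as `z → z₀`, `z ∈ Ω`. -/
def regularizing (ι : E →L[ℂ] X) (j : X →L[ℂ] F) (hj : Function.Injective j) (A : X →ₗ.[ℂ] X)
    (Ω : Set ℂ) (z₀ : ℂ) : Set (F →ₗ.[ℂ] E) :=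
  {B | B.IsClosed ∧ RelCompact (hat j hj A) B ∧
    Disjoint Ω (essSpec (perturbed ι j A B)) ∧
    (∃ δ > 0, Disjoint (Ω ∩ Metric.ball z₀ δ) (spec (perturbed ι j A B))) ∧
    ∃ R : E →WOT[ℂ] F, Tendsto (resolvEF ι j (perturbed ι j A B)) (𝓝[Ω] z₀) (𝓝 R)}

/-- `(T - z₀ I)⁻¹_Ω : E → F`, the limit of `j ∘ (T - z I)⁻¹ ∘ ι` in the weak operator topology
as `z → z₀`, `z ∈ Ω` (used only where the limit exists). -/
noncomputable def boundaryResolv (ι : E →L[ℂ] X) (j : X →L[ℂ] F) (T : X →ₗ.[ℂ] X)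
    (Ω : Set ℂ) (z₀ : ℂ) : E →L[ℂ] F :=
  (limUnder (𝓝[Ω] z₀) (resolvEF ι j T)).toCLM

/-- The space of virtual states, computed with `B̌`: the elements of the range of
`(A + B - z₀ I)⁻¹_Ω` that lie in `𝔇(Â)` and solve `(Â - z₀ I) Ψ = 0`. -/
noncomputable def virtualStates (ι : E →L[ℂ] X) (j : X →L[ℂ] F) (hj : Function.Injective j)
    (A : X →ₗ.[ℂ] X) (Ω : Set ℂ) (z₀ : ℂ) (B : F →ₗ.[ℂ] E) : Submodule ℂ F :=
  LinearMap.range (boundaryResolv ι j (perturbed ι j A B) Ω z₀ : E →ₗ[ℂ] F) ⊓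
    nullSpace (subScalar (hat j hj A) z₀)

/-- The operator `B̌ (A + B - z₀ I)⁻¹_Ω` in `E`. -/
noncomputable def birmanSchwinger (ι : E →L[ℂ] X) (j : X →L[ℂ] F) (A : X →ₗ.[ℂ] X)
    (Ω : Set ℂ) (z₀ : ℂ) (B : F →ₗ.[ℂ] E) : E →ₗ.[ℂ] E :=
  compCLM B (boundaryResolv ι j (perturbed ι j A B) Ω z₀)

end States

end VirtualLevels

/-! Let `G` be the limit of `j ∘ (A + B - z)⁻¹ ∘ ι` and `K = B̌ G`. By uniform boundedness and
relative bound zero, these resolvents are bounded near `z₀` into the graph norm of `Â`. Relative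
compactness then turns weak convergence of the resolvents into norm convergence after applying `B̌`,
or any other closed `Â`-compact operator. This makes `K` everywhere defined and compact, and the
resolvent equation survives the limit: `(Â - z₀) G φ = j ι (φ - K φ)`
(`IsBoundaryResolvent.mem_graph`).

Hence `G` is injective and maps `ker (1 - K)` onto `𝔐`, so `𝔐` is finite-dimensional. The resolvent
identity also survives the limit (`IsBoundaryResolvent.apply_eq`), so `G` has the same range for
every regularizing perturbation, and `𝔐` is independent of it.

For the rank, `ker (1 - K) ⊆ range K ⊆ range B̌` gives `dim 𝔐 ≤ rank B̌`. Conversely, index zero of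
`1 - K` yields `P` of rank at most `dim ker (1 - K)` with `1 - K + P G` invertible. A uniform lower
bound for the corresponding operators near `z₀` then shows that the resolvents of `A + P` converge
to `G (1 - K + P G)⁻¹` (`exists_of_finiteRank`). The spectrum of `A + P` in `Ω` is the zero set of
an analytic determinant which is not identically zero, so it is discrete. Thus `P` is regularizing
and the bound is attained.

If `rank B̌ = dim 𝔐`, the inclusions above are equalities, so `K` is a projection, and the root
lineal of the projection `1 - K` is its kernel. -/

namespace VirtualLevels

/-! ### Weak limits, and Riesz theory for `1 - K`. -/

section FunctionalAnalysis

variable {V W : Type*} [NormedAddCommGroup V] [NormedSpace ℂ V]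
  [NormedAddCommGroup W] [NormedSpace ℂ W]

/-- A closed subspace is weakly closed. -/
theorem mem_of_tendsto_weakly {α : Type*} {l : Filter α} [l.NeBot] {S : Submodule ℂ V}
    (hS : IsClosed (S : Set V)) {u : α → V} {x : V} (hu : ∀ᶠ a in l, u a ∈ S)
    (h : ∀ f : StrongDual ℂ V, Tendsto (fun a => f (u a)) l (𝓝 (f x))) : x ∈ S := by
  by_contra hx
  have : IsClosed (S : Set V) := hS
  have hne : ‖S.mkQ x‖ ≠ 0 := by
    rw [norm_ne_zero_iff]
    simpa using hx
  -- Hahn–Banach in `V ⧸ S`: a functional that vanishes on `S` but not at `x`.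
  obtain ⟨g, -, hg⟩ := exists_dual_vector ℂ (S.mkQ x) hne
  have h0 : g (S.mkQ x) = 0 := by
    refine tendsto_nhds_unique (h (g ∘L S.mkQL)) ?_
    refine tendsto_const_nhds.congr' ?_
    filter_upwards [hu] with a ha
    have : S.mkQ (u a) = 0 := by simpa using ha
    simpa using (congrArg g this).symm
  rw [h0] at hg
  exact hne (Complex.ofReal_eq_zero.1 hg.symm)

/-- A weakly convergent family of operators along a countably generated filter is eventually
bounded. -/
theorem eventually_norm_le_of_tendsto_weakly [CompleteSpace V] {α : Type*} {l : Filter α}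
    [l.IsCountablyGenerated] {G : α → V →L[ℂ] W} {G₀ : V →L[ℂ] W}
    (h : ∀ x, ∀ f : StrongDual ℂ W, Tendsto (fun a => f (G a x)) l (𝓝 (f (G₀ x)))) :
    ∃ C, ∀ᶠ a in l, ‖G a‖ ≤ C := by
  by_contra! hC
  -- Countable generation allows sampling an unbounded sequence along `l`. Uniform boundedness is
  -- then used twice: on the dual of `W` for each fixed `x`, and on `V`.
  obtain ⟨U, hU⟩ := l.exists_antitone_basis
  have hex : ∀ n : ℕ, ∃ a ∈ U n, (n : ℝ) < ‖G a‖ := by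
    intro n
    obtain ⟨a, ha, ha'⟩ := ((hC n).and_eventually (hU.mem n)).exists
    exact ⟨a, ha', not_le.1 (by simpa using ha)⟩
  choose s hs hsn using hex
  have hsl : Tendsto s atTop l := hU.tendsto hs
  have hb : ∀ x, ∃ C, ∀ n, ‖G (s n) x‖ ≤ C := by
    intro x
    obtain ⟨C, hC⟩ := banach_steinhaus
      (g := fun n => NormedSpace.inclusionInDoubleDual ℂ W (G (s n) x)) (fun f => by
        obtain ⟨C, hC⟩ := ((h x f).comp hsl).norm.bddAbove_range
        exact ⟨C, fun n => hC ⟨n, rfl⟩⟩)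
    refine ⟨C, fun n => ?_⟩
    have := hC n
    rwa [show NormedSpace.inclusionInDoubleDual ℂ W (G (s n) x) =
      NormedSpace.inclusionInDoubleDualLi ℂ (G (s n) x) from rfl, LinearIsometry.norm_map] at this
  obtain ⟨C, hC⟩ := banach_steinhaus hb
  obtain ⟨n, hn⟩ := exists_nat_gt C
  linarith [hC n, hsn n]

theorem isCompactOperator_sum_smulRight {r : ℕ} (g : Fin r → StrongDual ℂ V) (a : Fin r → W) :
    IsCompactOperator (∑ i, (g i).smulRight (a i) : V →L[ℂ] W) := by
  have : ∑ i, (g i).smulRight (a i) ∈ compactOperator (RingHom.id ℂ) V W := by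
    refine Submodule.sum_mem _ fun i _ => ?_
    have h1 : IsCompactOperator (g i) := isCompactOperator_of_locallyCompactSpace_dom (g i)
    exact h1.clm_comp (ContinuousLinearMap.toSpanSingleton ℂ (a i))
  exact this

/-- `K` restricts to the identity on the kernel, and a compact identity forces finite dimension. -/
theorem finiteDimensional_ker_one_sub {K : V →L[ℂ] V} (hK : IsCompactOperator K) :
    FiniteDimensional ℂ (LinearMap.ker ((1 - K : V →L[ℂ] V) : V →ₗ[ℂ] V)) := by
  set N := LinearMap.ker ((1 - K : V →L[ℂ] V) : V →ₗ[ℂ] V) with hN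
  have hfix : ∀ x ∈ N, K x = x := fun x hx => by
    have : x - K x = 0 := by simpa [hN] using hx
    exact (sub_eq_zero.1 this).symm
  have hmaps : ∀ x ∈ N, (K : V →ₗ[ℂ] V) x ∈ N := fun x hx => by
    have := hfix x hx
    simp only [ContinuousLinearMap.coe_coe, this, hx]
  have hcl : IsClosed (N : Set V) := (1 - K : V →L[ℂ] V).isClosed_ker
  have hK' : IsCompactOperator (K : V →ₗ[ℂ] V) := hK
  have h1 := hK'.restrict hmaps hcl
  refine FiniteDimensional.of_isCompactOperator_id (𝕜 := ℂ) ?_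
  have h2 : (id : N → N) = (K : V →ₗ[ℂ] V).restrict hmaps := by
    funext x
    exact Subtype.ext (hfix x x.2).symm
  rw [h2]
  exact h1

variable [CompleteSpace V]

/-- The Fredholm alternative: `1 - K` with `K` compact is bijective as soon as it is injective. -/
theorem bijective_one_sub_of_injective {K : V →L[ℂ] V} (hK : IsCompactOperator K)
    (h : ∀ x, x = K x → x = 0) : Function.Bijective (1 - K : V →L[ℂ] V) := by
  rcases hK.hasEigenvalue_or_mem_resolventSet (one_ne_zero (α := ℂ)) with h1 | h1
  · obtain ⟨v, hv⟩ := h1.exists_hasEigenvector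
    refine absurd (h v ?_) hv.2
    simpa using hv.apply_eq_smul.symm
  · rw [spectrum.mem_resolventSet_iff, ContinuousLinearMap.isUnit_iff_bijective] at h1
    simpa using h1

/-- The kernel is finite-dimensional, hence complemented, so `T = 1 - K` has a bounded right inverse
`R`. Since `R = 1 + K R` is an injective compact perturbation of the identity, it is bijective, and
`T` is its inverse. -/
theorem injective_one_sub_of_surjective {K : V →L[ℂ] V} (hK : IsCompactOperator K)
    (h : Function.Surjective (1 - K : V →L[ℂ] V)) :
    Function.Injective (1 - K : V →L[ℂ] V) := by
  set T : V →L[ℂ] V := 1 - K with hT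
  have hfin : FiniteDimensional ℂ (LinearMap.ker (T : V →ₗ[ℂ] V)) :=
    finiteDimensional_ker_one_sub hK
  obtain ⟨R, hR⟩ : ∃ R : V →L[ℂ] V, ∀ x, T (R x) = x := by
    obtain ⟨P, hP⟩ := Submodule.ClosedComplemented.of_finiteDimensional
      (LinearMap.ker (T : V →ₗ[ℂ] V))
    let e := T.equivProdOfSurjectiveOfIsCompl P (LinearMap.range_eq_top.2 h)
      (LinearMap.range_eq_top.2 fun y => ⟨y, hP y⟩) (LinearMap.isCompl_of_proj hP)
    refine ⟨(e.symm : _ →L[ℂ] V) ∘L ContinuousLinearMap.inl ℂ V (LinearMap.ker (T : V →ₗ[ℂ] V)),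
      fun x => ?_⟩
    exact congrArg Prod.fst (e.apply_symm_apply (x, 0))
  have hRK : ∀ x, R x = x + K (R x) := fun x => by
    have := hR x
    simp only [hT, sub_apply, one_apply_eq_self] at this
    exact eq_add_of_sub_eq this
  have hb : Function.Bijective (1 - (-(K ∘L R)) : V →L[ℂ] V) := by
    refine bijective_one_sub_of_injective (hK.comp_clm R).neg fun x hx => ?_
    have h1 : R x = 0 := by
      rw [hRK]
      nth_rw 1 [hx]
      simp
    rw [← hR x, h1, map_zero]
  have hRs : Function.Surjective R := fun y => by
    obtain ⟨x, hx⟩ := hb.2 y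
    refine ⟨x, ?_⟩
    rw [hRK, ← hx]
    simp
  intro x y hxy
  obtain ⟨x, rfl⟩ := hRs x
  obtain ⟨y, rfl⟩ := hRs y
  rw [hR, hR] at hxy
  rw [hxy]

/-- Used with the cokernel of `1 - K` and `r` the dimension of its kernel; the second alternative is
where the cokernel would be smaller than the kernel. -/
theorem exists_linearMap_injective_or_surjective (Q : Type*) [AddCommGroup Q] [Module ℂ Q]
    (r : ℕ) : ∃ L : (Fin r → ℂ) →ₗ[ℂ] Q,
      Function.Injective L ∨ (Function.Surjective L ∧ ¬ Function.Injective L) := by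
  by_cases hr : (r : Cardinal) ≤ Module.rank ℂ Q
  · obtain ⟨v, hv⟩ := Module.le_rank_iff_exists_linearMap.1 hr
    exact ⟨v, Or.inl hv⟩
  · push Not at hr
    have hfin : Module.Finite ℂ Q :=
      Module.rank_lt_aleph0_iff.1 (hr.trans (Cardinal.natCast_lt_aleph0))
    have hlt : Module.finrank ℂ Q < r := by
      rw [← Module.finrank_eq_rank] at hr
      exact_mod_cast hr
    let e := (Module.finBasis ℂ Q).equivFun
    refine ⟨e.symm.toLinearMap ∘ₗ LinearMap.funLeft ℂ ℂ (Fin.castLE hlt.le), Or.inr ⟨?_, ?_⟩⟩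
    · exact e.symm.surjective.comp
        (LinearMap.funLeft_surjective_of_injective ℂ ℂ _ (Fin.castLE_injective _))
    · intro hinj
      have := LinearMap.finrank_le_finrank_of_injective hinj
      simp at this
      omega

/-- A compact perturbation `1 - K` of the identity becomes injective after the addition of a
suitable operator of rank at most `r = dim ker (1 - K)`. -/
theorem exists_finiteRank_correction {K : V →L[ℂ] V} (hK : IsCompactOperator K) {r : ℕ}
    {T : V →L[ℂ] V} (hT : T = 1 - K)
    (φ : Module.Basis (Fin r) ℂ (LinearMap.ker (T : V →ₗ[ℂ] V)))
    (g : Fin r → StrongDual ℂ V) (hg : ∀ i k, g i (φ k) = if i = k then 1 else 0) :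
    ∃ a : Fin r → V, ∀ x, x - K x + ∑ i, g i x • a i = 0 → x = 0 := by
  obtain ⟨L, hL⟩ := exists_linearMap_injective_or_surjective
    (V ⧸ LinearMap.range (T : V →ₗ[ℂ] V)) r
  have hex : ∀ i, ∃ a : V, (LinearMap.range (T : V →ₗ[ℂ] V)).mkQ a = L (Pi.single i 1) :=
    fun i => Submodule.mkQ_surjective _ _
  choose a ha using hex
  have haL : ∀ c : Fin r → ℂ, (LinearMap.range (T : V →ₗ[ℂ] V)).mkQ (∑ i, c i • a i) = L c := by
    intro c
    conv_rhs => rw [pi_eq_sum_univ' c]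
    simp only [map_sum, map_smul, ha]
  have hφT : ∀ k, T (φ k : V) = 0 := fun k => LinearMap.mem_ker.1 (φ k).2
  have hker : ∀ x, T x = 0 → (∀ i, g i x = 0) → x = 0 := by
    intro x hx hgx
    have h1 := congrArg (Subtype.val) (φ.sum_repr ⟨x, LinearMap.mem_ker.2 hx⟩)
    simp only [Submodule.coe_sum, Submodule.coe_smul] at h1
    rw [← h1]
    refine Finset.sum_eq_zero fun i _ => ?_
    have h2 := hgx i
    rw [← h1] at h2
    simp only [map_sum, map_smul, hg, smul_eq_mul, mul_ite, mul_one, mul_zero,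
      Finset.sum_ite_eq, Finset.mem_univ, if_true] at h2
    rw [h2, zero_smul]
  have hinj : Function.Injective L := by
    -- In the second case `T + S` would be surjective, hence injective, which in turn forces `L` to
    -- be injective.
    rcases hL with hL | ⟨hs, hni⟩
    · exact hL
    · exfalso
      set S : V →L[ℂ] V := ∑ i, (g i).smulRight (a i) with hS
      have hSx : ∀ x, S x = ∑ i, g i x • a i := fun x => by simp [hS]
      have hSc : IsCompactOperator S := isCompactOperator_sum_smulRight g a
      have hsurj : Function.Surjective (1 - (K - S) : V →L[ℂ] V) := by
        intro y
        obtain ⟨c, hc⟩ := hs ((LinearMap.range (T : V →ₗ[ℂ] V)).mkQ y)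
        rw [← haL, ← sub_eq_zero, ← map_sub, Submodule.mkQ_apply,
          Submodule.Quotient.mk_eq_zero] at hc
        obtain ⟨u, hu⟩ := hc
        have hu' : T u = ∑ i, c i • a i - y := hu
        -- The kernel part does not affect `T` and sets every `g i` to `c i`; so `T` contributes `y
        -- - ∑ c i • a i` and `S` contributes `∑ c i • a i`.
        refine ⟨-u + ∑ k, (c k + g k u) • (φ k : V), ?_⟩
        have h1 : ∀ x, (1 - (K - S) : V →L[ℂ] V) x = T x + S x := fun x => by
          simp [hT]; abel
        have h2 : ∀ i, g i (-u + ∑ k, (c k + g k u) • (φ k : V)) = c i := fun i => by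
          simp [hg, Finset.sum_ite_eq]
        rw [h1, hSx]
        simp only [h2]
        simp [hφT, hu']
      have hi := injective_one_sub_of_surjective (hK.sub hSc) hsurj
      apply hni
      rw [injective_iff_map_eq_zero]
      intro c hc
      rw [← haL, Submodule.mkQ_apply, Submodule.Quotient.mk_eq_zero] at hc
      obtain ⟨u, hu⟩ := hc
      have hu' : T u = ∑ i, c i • a i := hu
      have h1 : ∀ x, (1 - (K - S) : V →L[ℂ] V) x = T x + S x := fun x => by
        simp [hT]; abel
      have h2 : ∀ i, g i (-u + ∑ k, (c k + g k u) • (φ k : V)) = c i := fun i => by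
        simp [hg]
      have h3 : -u + ∑ k, (c k + g k u) • (φ k : V) = 0 := by
        apply hi
        rw [h1, hSx]
        simp only [h2]
        simp [hφT, hu']
      funext i
      rw [← h2 i, h3]
      simp
  refine ⟨a, fun x hx => ?_⟩
  have hTx : T x + ∑ i, g i x • a i = 0 := by simpa [hT] using hx
  -- The correction equals `-T x`, so its class in the cokernel vanishes; injectivity of `L`
  -- separates the two terms.
  have h1 : L (fun i => g i x) = 0 := by
    rw [← haL, Submodule.mkQ_apply, Submodule.Quotient.mk_eq_zero]
    refine ⟨-x, ?_⟩
    rw [map_neg]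
    exact neg_eq_of_add_eq_zero_right hTx
  have h2 : ∀ i, g i x = 0 := fun i => congrFun ((injective_iff_map_eq_zero L).1 hinj _ h1) i
  refine hker x ?_ h2
  simpa [h2] using hTx

end FunctionalAnalysis

end VirtualLevels

namespace VirtualLevels

/-! ### Closed relatively compact operators. -/

section RelativeCompactness

variable {E F : Type*} [NormedAddCommGroup E] [NormedSpace ℂ E]
  [NormedAddCommGroup F] [NormedSpace ℂ F]
  {T : F →ₗ.[ℂ] F} {B : F →ₗ.[ℂ] E}

theorem RelCompact.exists_mem_graph (h : RelCompact T B) {ψ y : F} (hy : (ψ, y) ∈ T.graph) :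
    ∃ e, (ψ, e) ∈ B.graph := by
  obtain ⟨h, -⟩ := h
  exact LinearPMap.mem_domain_iff.1 (h (LinearPMap.mem_domain_of_mem_graph hy))

theorem RelCompact.exists_isCompact (h : RelCompact T B) (M : ℝ) :
    ∃ S : Set E, IsCompact S ∧ ∀ ψ y e, (ψ, y) ∈ T.graph → (ψ, e) ∈ B.graph →
      ‖ψ‖ + ‖y‖ ≤ M → e ∈ S := by
  obtain ⟨h, hc⟩ := h
  -- Positive and strictly larger than `M`, because the unit ball in `RelCompact` is open.
  set M' : ℝ := max M 0 + 1 with hM'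
  have hpos : 0 < M' := by positivity
  have hne : (M' : ℂ) ≠ 0 := by exact_mod_cast hpos.ne'
  refine ⟨_, hc.image (continuous_const_smul (M' : ℂ)), ?_⟩
  intro ψ y e hy he hM
  rw [LinearPMap.mem_graph_iff] at hy he
  obtain ⟨u, hu, huy⟩ := hy
  obtain ⟨v, hv, hve⟩ := he
  refine ⟨(M' : ℂ)⁻¹ • e, subset_closure ⟨(M' : ℂ)⁻¹ • u, ?_, ?_⟩, smul_inv_smul₀ hne e⟩
  · rw [LinearPMap.map_smul, Submodule.coe_smul, norm_smul, norm_smul, ← mul_add, norm_inv,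
      Complex.norm_real, Real.norm_of_nonneg hpos.le, inv_mul_lt_iff₀ hpos, mul_one, hu, huy]
    have := le_max_left M 0
    simp only at hM ⊢
    linarith
  · have : Submodule.inclusion h ((M' : ℂ)⁻¹ • u) = (M' : ℂ)⁻¹ • v := by
      apply Subtype.ext
      simp [hu, hv]
    rw [this, LinearPMap.map_smul, hve]

/-- If `Ψ a` converges weakly and is bounded in the graph norm of `T`, and if `B` is closed and
`T`-compact, then `B (Ψ a)` converges in norm. -/
theorem RelCompact.tendsto_of_tendsto_weakly (h : RelCompact T B) (hB : B.IsClosed)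
    {α : Type*} {l : Filter α} [l.NeBot] {Ψ : α → F} {e : α → E} {Ψ₀ : F} {M : ℝ}
    (hy : ∀ᶠ a in l, ∃ y, (Ψ a, y) ∈ T.graph ∧ ‖Ψ a‖ + ‖y‖ ≤ M)
    (he : ∀ᶠ a in l, (Ψ a, e a) ∈ B.graph)
    (hΨ : ∀ f : StrongDual ℂ F, Tendsto (fun a => f (Ψ a)) l (𝓝 (f Ψ₀))) :
    ∃ e₀, (Ψ₀, e₀) ∈ B.graph ∧ Tendsto e l (𝓝 e₀) := by
  obtain ⟨S, hS, hSe⟩ := h.exists_isCompact M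
  have heS : ∀ᶠ a in l, e a ∈ S := by
    filter_upwards [hy, he] with a ⟨y, h1, h2⟩ h3
    exact hSe _ _ _ h1 h3 h2
  -- Compactness gives a limit along each ultrafilter; the weakly closed graph of `B` forces all
  -- these limits to be the value of `B` at `Ψ₀`.
  have key : ∀ U : Ultrafilter α, (U : Filter α) ≤ l →
      ∃ e₀, (Ψ₀, e₀) ∈ B.graph ∧ Tendsto e U (𝓝 e₀) := by
    intro U hU
    have hmap : ((U.map e : Ultrafilter E) : Filter E) ≤ 𝓟 S :=
      le_principal_iff.2 (hU heS)
    obtain ⟨e₀, -, he₀⟩ := hS.ultrafilter_le_nhds (U.map e) hmap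
    have ht : Tendsto e U (𝓝 e₀) := he₀
    refine ⟨e₀, ?_, ht⟩
    refine mem_of_tendsto_weakly (l := (U : Filter α)) (u := fun a => (Ψ a, e a)) hB (hU he) ?_
    intro f
    have h1 := ((hΨ (f ∘L ContinuousLinearMap.inl ℂ F E)).mono_left hU).add
      (((f ∘L ContinuousLinearMap.inr ℂ F E).continuous.tendsto e₀).comp ht)
    have h2 : ∀ (a : F) (b : E), f (a, b) = (f ∘L ContinuousLinearMap.inl ℂ F E) a +
        (f ∘L ContinuousLinearMap.inr ℂ F E) b := fun a b => by
      rw [ContinuousLinearMap.comp_apply, ContinuousLinearMap.comp_apply, ← map_add]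
      simp
    simp only [h2]
    exact h1
  obtain ⟨e₀, he₀, -⟩ := key (Ultrafilter.of l) (Ultrafilter.of_le l)
  refine ⟨e₀, he₀, tendsto_iff_ultrafilter _ _ _ |>.2 fun U hU => ?_⟩
  obtain ⟨e₁, he₁, ht⟩ := key U hU
  rwa [B.mem_graph_snd_inj he₀ he₁ rfl]

/-- A closed `T`-compact operator is `T`-bounded with relative bound zero. -/
theorem RelCompact.relative_bound_zero (h : RelCompact T B) (hB : B.IsClosed) {ε : ℝ}
    (hε : 0 < ε) : ∃ C, 0 ≤ C ∧ ∀ ψ y e, (ψ, y) ∈ T.graph → (ψ, e) ∈ B.graph →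
      ‖e‖ ≤ ε * ‖y‖ + C * ‖ψ‖ := by
  by_contra! hC
  have hex : ∀ n : ℕ, ∃ ψ y e, (ψ, y) ∈ T.graph ∧ (ψ, e) ∈ B.graph ∧ ‖ψ‖ + ‖y‖ = 1 ∧
      ε * ‖y‖ + n * ‖ψ‖ < ‖e‖ := by
    intro n
    obtain ⟨ψ, y, e, hy, he, hlt⟩ := hC n n.cast_nonneg
    have hs : 0 < ‖ψ‖ + ‖y‖ := by
      refine lt_of_le_of_ne (by positivity) fun h0 => ?_
      have h1 : ‖ψ‖ = 0 := by linarith [norm_nonneg ψ, norm_nonneg y]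
      have h2 : ψ = 0 := norm_eq_zero.1 h1
      have h3 : e = 0 := B.graph_fst_eq_zero_snd he h2
      rw [h3, norm_zero] at hlt
      exact absurd hlt (not_lt.2 (by positivity))
    set s := ‖ψ‖ + ‖y‖ with hsd
    have hn : ‖((s⁻¹ : ℝ) : ℂ)‖ = s⁻¹ := by
      rw [Complex.norm_real, Real.norm_of_nonneg (by positivity)]
    refine ⟨((s⁻¹ : ℝ) : ℂ) • ψ, ((s⁻¹ : ℝ) : ℂ) • y, ((s⁻¹ : ℝ) : ℂ) • e,
      T.graph.smul_mem _ hy, B.graph.smul_mem _ he, ?_, ?_⟩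
    · rw [norm_smul, norm_smul, hn, ← mul_add, ← hsd, inv_mul_cancel₀ hs.ne']
    · rw [norm_smul, norm_smul, norm_smul, hn]
      have := mul_lt_mul_of_pos_left hlt (inv_pos.2 hs)
      linarith
  choose ψ y e hy he hn hlt using hex
  obtain ⟨S, hS, hSe⟩ := h.exists_isCompact 1
  obtain ⟨M, hM⟩ := hS.isBounded.exists_norm_le
  have heM : ∀ n, ‖e n‖ ≤ M := fun n => hM _ (hSe _ _ _ (hy n) (he n) (hn n).le)
  -- With graph norm one and `e n` bounded, `n * ‖ψ n‖` is bounded. Then `e n → 0` by compactness,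
  -- while `‖e n‖ > ε * ‖y n‖ = ε * (1 - ‖ψ n‖) → ε`.
  have hψ : Tendsto ψ atTop (𝓝 0) := by
    rw [tendsto_zero_iff_norm_tendsto_zero]
    refine squeeze_zero' (g := fun n : ℕ => M / n) (Eventually.of_forall fun n => norm_nonneg _) ?_
      (tendsto_const_div_atTop_nhds_zero_nat M)
    filter_upwards [eventually_gt_atTop 0] with n hn0
    rw [le_div_iff₀ (by exact_mod_cast hn0)]
    have := hlt n
    have h3 := heM n
    have h4 : 0 ≤ ε * ‖y n‖ := by positivity
    linarith
  obtain ⟨e₀, he₀, hte⟩ := h.tendsto_of_tendsto_weakly hB (l := atTop) (Ψ := ψ) (e := e) (M := 1)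
    (Eventually.of_forall fun n => ⟨y n, hy n, (hn n).le⟩) (Eventually.of_forall he)
    (fun f => (f.continuous.tendsto 0).comp hψ)
  have he0 : e₀ = 0 := B.graph_fst_eq_zero_snd he₀ rfl
  rw [he0] at hte
  have h1 : Tendsto (fun n => ε * (1 - ‖ψ n‖)) atTop (𝓝 (ε * (1 - 0))) := by
    have := hψ.norm
    rw [norm_zero] at this
    exact (tendsto_const_nhds.sub this).const_mul ε
  have h2 : Tendsto (fun n => ‖e n‖) atTop (𝓝 0) := by simpa using hte.norm
  have h3 := le_of_tendsto_of_tendsto' h1 h2 fun n => by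
    have h4 := hlt n
    have h5 : 1 - ‖ψ n‖ = ‖y n‖ := by linarith [hn n]
    rw [h5]
    have h6 : 0 ≤ (n : ℝ) * ‖ψ n‖ := by positivity
    linarith
  linarith

/-- The graph norm of `T` is controlled by that of `T + c ∘ B`. -/
theorem RelCompact.norm_le (h : RelCompact T B) (hB : B.IsClosed) (c : E →L[ℂ] F) :
    ∃ C, 0 ≤ C ∧ ∀ ψ y e, (ψ, y) ∈ T.graph → (ψ, e) ∈ B.graph →
      ‖y‖ ≤ 2 * ‖y + c e‖ + C * ‖ψ‖ := by
  -- With this `ε` one has `‖c‖ * ε ≤ 1 / 2`, so the `‖y‖` term is absorbed on the left.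
  obtain ⟨C, hC0, hC⟩ := h.relative_bound_zero hB (ε := (2 * (‖c‖ + 1))⁻¹) (by positivity)
  refine ⟨2 * ‖c‖ * C, by positivity, fun ψ y e hy he => ?_⟩
  have h1 : ‖y‖ ≤ ‖y + c e‖ + ‖c‖ * ‖e‖ := by
    calc ‖y‖ = ‖(y + c e) - c e‖ := by simp
      _ ≤ ‖y + c e‖ + ‖c e‖ := norm_sub_le _ _
      _ ≤ _ := by gcongr; exact c.le_opNorm e
  have h2 := mul_le_mul_of_nonneg_left (hC ψ y e hy he) (norm_nonneg c)
  have h3 : ‖c‖ * (2 * (‖c‖ + 1))⁻¹ ≤ 1 / 2 := by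
    rw [← div_eq_mul_inv, div_le_iff₀ (by positivity)]
    linarith
  have h4 := mul_le_mul_of_nonneg_right h3 (norm_nonneg y)
  nlinarith

end RelativeCompactness

end VirtualLevels

namespace VirtualLevels

/-! ### Weak limits of operators bounded into the graph norm. -/

section BoundaryLimits

variable {E F : Type*} [NormedAddCommGroup E] [NormedSpace ℂ E]
  [NormedAddCommGroup F] [NormedSpace ℂ F]

/-- The family `G` of bounded operators converges to `G₀` in the weak operator topology along `l`
and is eventually bounded as a family of operators from `E` to `𝔇(T)` with the graph norm. -/
structure GraphBoundedLimit {α : Type*} (T : F →ₗ.[ℂ] F) (l : Filter α) (G : α → E →L[ℂ] F)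
    (G₀ : E →L[ℂ] F) : Prop where
  weak : ∀ x, ∀ f : StrongDual ℂ F, Tendsto (fun a => f (G a x)) l (𝓝 (f (G₀ x)))
  bound : ∃ M : ℝ, 0 ≤ M ∧ ∀ᶠ a in l, ∀ φ, ∃ y, (G a φ, y) ∈ T.graph ∧ ‖G a φ‖ + ‖y‖ ≤ M * ‖φ‖

namespace GraphBoundedLimit

variable {α : Type*} {T : F →ₗ.[ℂ] F} {l : Filter α} {G : α → E →L[ℂ] F} {G₀ : E →L[ℂ] F}

/-- The uniform bound on `G a` lets the argument vary in norm while the operators converge only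
weakly. -/
theorem tendsto_apply (h : GraphBoundedLimit T l G G₀) {β : Type*} {m : Filter β} {s : β → α}
    (hs : Tendsto s m l) {φ : β → E} {φ₀ : E} (hφ : Tendsto φ m (𝓝 φ₀)) (f : StrongDual ℂ F) :
    Tendsto (fun b => f (G (s b) (φ b))) m (𝓝 (f (G₀ φ₀))) := by
  obtain ⟨M, hM0, hM⟩ := h.bound
  have h1 : Tendsto (fun b => f (G (s b) (φ b - φ₀))) m (𝓝 0) := by
    rw [tendsto_zero_iff_norm_tendsto_zero]
    have h2 : Tendsto (fun b => ‖f‖ * (M * ‖φ b - φ₀‖)) m (𝓝 0) := by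
      have := ((hφ.sub_const φ₀).norm.const_mul M).const_mul ‖f‖
      simpa using this
    refine squeeze_zero' (Eventually.of_forall fun b => norm_nonneg _) ?_ h2
    filter_upwards [hs.eventually hM] with b hb
    obtain ⟨y, -, hy⟩ := hb (φ b - φ₀)
    refine (f.le_opNorm _).trans ?_
    gcongr
    linarith [norm_nonneg y]
  have h3 := h1.add ((h.weak φ₀ f).comp hs)
  rw [zero_add] at h3
  refine h3.congr fun b => ?_
  simp

theorem tendsto_of_mem_graph (h : GraphBoundedLimit T l G G₀) {B : F →ₗ.[ℂ] E}
    (hBc : B.IsClosed) (hBT : RelCompact T B) {β : Type*} {m : Filter β} [m.NeBot] {s : β → α}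
    (hs : Tendsto s m l) {φ : β → E} {φ₀ : E} (hφ : Tendsto φ m (𝓝 φ₀)) {e : β → E}
    (he : ∀ᶠ b in m, (G (s b) (φ b), e b) ∈ B.graph) :
    ∃ e₀, (G₀ φ₀, e₀) ∈ B.graph ∧ Tendsto e m (𝓝 e₀) := by
  obtain ⟨M, hM0, hM⟩ := h.bound
  refine hBT.tendsto_of_tendsto_weakly hBc (M := M * (‖φ₀‖ + 1)) ?_ he (h.tendsto_apply hs hφ)
  have h1 : ∀ᶠ b in m, ‖φ b‖ < ‖φ₀‖ + 1 := hφ.norm.eventually (gt_mem_nhds (lt_add_one _))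
  filter_upwards [hs.eventually hM, h1] with b hb hb1
  obtain ⟨y, hy, hy1⟩ := hb (φ b)
  exact ⟨y, hy, hy1.trans (by gcongr)⟩

theorem exists_tendsto (h : GraphBoundedLimit T l G G₀) [l.NeBot] {B : F →ₗ.[ℂ] E}
    (hBc : B.IsClosed) (hBT : RelCompact T B) (φ : E) :
    ∃ e₀, (G₀ φ, e₀) ∈ B.graph ∧
      ∀ e : α → E, (∀ᶠ a in l, (G a φ, e a) ∈ B.graph) → Tendsto e l (𝓝 e₀) := by
  obtain ⟨M, hM0, hM⟩ := h.bound
  have hex : ∀ a, ∃ e, (∀ φ, ∃ y, (G a φ, y) ∈ T.graph ∧ ‖G a φ‖ + ‖y‖ ≤ M * ‖φ‖) →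
      (G a φ, e) ∈ B.graph := by
    intro a
    by_cases ha : ∀ φ, ∃ y, (G a φ, y) ∈ T.graph ∧ ‖G a φ‖ + ‖y‖ ≤ M * ‖φ‖
    · obtain ⟨y, hy, -⟩ := ha φ
      obtain ⟨e, he⟩ := hBT.exists_mem_graph hy
      exact ⟨e, fun _ => he⟩
    · exact ⟨0, fun h => absurd h ha⟩
  choose e he using hex
  obtain ⟨e₀, he₀, -⟩ := h.tendsto_of_mem_graph hBc hBT (φ := fun _ => φ) (e := e) tendsto_id
    tendsto_const_nhds (by filter_upwards [hM] with a ha using he a ha)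
  refine ⟨e₀, he₀, fun e' he' => ?_⟩
  obtain ⟨e₁, he₁, ht⟩ := h.tendsto_of_mem_graph hBc hBT (φ := fun _ => φ) (e := e') tendsto_id
    tendsto_const_nhds he'
  rwa [B.mem_graph_snd_inj he₀ he₁ rfl]

/-- `B ∘ G₀` is everywhere defined and compact. -/
theorem exists_compact_comp (h : GraphBoundedLimit T l G G₀) [l.NeBot] {B : F →ₗ.[ℂ] E}
    (hBc : B.IsClosed) (hBT : RelCompact T B) :
    ∃ K : E →L[ℂ] E, IsCompactOperator K ∧ ∀ φ, (G₀ φ, K φ) ∈ B.graph := by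
  have hex : ∀ φ, ∃ e₀, (G₀ φ, e₀) ∈ B.graph ∧
      ∀ e : α → E, (∀ᶠ a in l, (G a φ, e a) ∈ B.graph) → Tendsto e l (𝓝 e₀) :=
    fun φ => h.exists_tendsto hBc hBT φ
  choose k hk hkt using hex
  let K₀ : E →ₗ[ℂ] E :=
    { toFun := k
      map_add' := fun x y => B.mem_graph_snd_inj (hk (x + y)) (B.graph.add_mem (hk x) (hk y))
        (map_add G₀ x y)
      map_smul' := fun c x => B.mem_graph_snd_inj (hk (c • x)) (B.graph.smul_mem c (hk x))
        (map_smul G₀ c x) }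
  obtain ⟨M, hM0, hM⟩ := h.bound
  obtain ⟨S, hS, hSe⟩ := hBT.exists_isCompact M
  have hK₀ : IsCompactOperator K₀ := by
    refine ⟨S, hS, mem_of_superset (Metric.closedBall_mem_nhds 0 one_pos) fun φ hφ => ?_⟩
    have hφ1 : ‖φ‖ ≤ 1 := by simpa using hφ
    have hex : ∀ a, ∃ e, (∀ φ, ∃ y, (G a φ, y) ∈ T.graph ∧ ‖G a φ‖ + ‖y‖ ≤ M * ‖φ‖) →
        (G a φ, e) ∈ B.graph ∧ e ∈ S := by
      intro a
      by_cases ha : ∀ φ, ∃ y, (G a φ, y) ∈ T.graph ∧ ‖G a φ‖ + ‖y‖ ≤ M * ‖φ‖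
      · obtain ⟨y, hy, hyM⟩ := ha φ
        obtain ⟨e, he⟩ := hBT.exists_mem_graph hy
        exact ⟨e, fun _ => ⟨he, hSe _ _ _ hy he
          (hyM.trans (mul_le_of_le_one_right hM0 hφ1))⟩⟩
      · exact ⟨0, fun h => absurd h ha⟩
    choose e he using hex
    refine hS.isClosed.mem_of_tendsto (hkt φ e ?_) ?_
    · filter_upwards [hM] with a ha using (he a ha).1
    · filter_upwards [hM] with a ha using (he a ha).2
  exact ⟨ContinuousLinearMap.mkOfIsCompactOperator hK₀, hK₀, hk⟩

/-- If `1 - (B - B') ∘ G₀` is injective, then `1 - (B - B') ∘ G a` is eventually bounded below,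
uniformly in `a`. -/
theorem eventually_bounded_below (h : GraphBoundedLimit T l G G₀) [l.IsCountablyGenerated]
    {B B' : F →ₗ.[ℂ] E} (hBc : B.IsClosed) (hBT : RelCompact T B) (hBc' : B'.IsClosed)
    (hBT' : RelCompact T B')
    (hinj : ∀ φ k k', (G₀ φ, k) ∈ B.graph → (G₀ φ, k') ∈ B'.graph → φ = k - k' → φ = 0) :
    ∃ δ > 0, ∀ᶠ a in l, ∀ φ e e', (G a φ, e) ∈ B.graph → (G a φ, e') ∈ B'.graph →
      δ * ‖φ‖ ≤ ‖φ - e + e'‖ := by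
  by_contra! hC
  obtain ⟨M, hM0, hM⟩ := h.bound
  obtain ⟨U, hU⟩ := l.exists_antitone_basis
  have hex : ∀ n : ℕ, ∃ a ∈ U n, ∃ φ e e' y, (G a φ, e) ∈ B.graph ∧ (G a φ, e') ∈ B'.graph ∧
      (G a φ, y) ∈ T.graph ∧ ‖G a φ‖ + ‖y‖ ≤ M ∧ ‖φ‖ = 1 ∧
      ‖φ - e + e'‖ ≤ 1 / ((n : ℝ) + 1) := by
    intro n
    obtain ⟨a, ⟨ha, haU⟩, haM⟩ := (((hC (1 / ((n : ℝ) + 1)) (by positivity)).and_eventually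
      (hU.mem n)).and_eventually hM).exists
    obtain ⟨φ, e, e', he, he', hlt⟩ := ha
    have hφ : 0 < ‖φ‖ := by
      refine lt_of_le_of_ne (norm_nonneg _) fun h0 => ?_
      have h1 : φ = 0 := norm_eq_zero.1 h0.symm
      have h2 : G a φ = 0 := by rw [h1, map_zero]
      have h3 : e = 0 := B.graph_fst_eq_zero_snd he h2
      have h4 : e' = 0 := B'.graph_fst_eq_zero_snd he' h2
      rw [h1, h3, h4] at hlt
      simp at hlt
    set c : ℂ := ((‖φ‖⁻¹ : ℝ) : ℂ) with hc
    have hcn : ‖c‖ = ‖φ‖⁻¹ := by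
      rw [hc, Complex.norm_real, Real.norm_of_nonneg (by positivity)]
    have hn : ‖c • φ‖ = 1 := by rw [norm_smul, hcn, inv_mul_cancel₀ hφ.ne']
    obtain ⟨y, hy, hyM⟩ := haM (c • φ)
    rw [hn, mul_one] at hyM
    refine ⟨a, haU, c • φ, c • e, c • e', y, ?_, ?_, hy, hyM, hn, ?_⟩
    · rw [map_smul]; exact B.graph.smul_mem c he
    · rw [map_smul]; exact B'.graph.smul_mem c he'
    · rw [← smul_sub, ← smul_add, norm_smul, hcn, inv_mul_le_iff₀ hφ, mul_comm]
      exact hlt.le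
  choose s hs φ e e' y he he' hy hyM hφ hlt using hex
  have hsl : Tendsto s atTop l := hU.tendsto hs
  let m : Ultrafilter ℕ := Ultrafilter.of atTop
  have hm : (m : Filter ℕ) ≤ atTop := Ultrafilter.of_le atTop
  have hlim : ∀ {B : F →ₗ.[ℂ] E}, RelCompact T B → ∀ e : ℕ → E,
      (∀ n, (G (s n) (φ n), e n) ∈ B.graph) → ∃ e₀, Tendsto e m (𝓝 e₀) := by
    intro B hBT e he
    obtain ⟨S, hS, hSe⟩ := hBT.exists_isCompact M
    have hmap : ((m.map e : Ultrafilter E) : Filter E) ≤ 𝓟 S :=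
      le_principal_iff.2 (Ultrafilter.mem_map.2
        (univ_mem' fun n => hSe _ _ _ (hy n) (he n) (hyM n)))
    obtain ⟨e₀, -, he₀⟩ := hS.ultrafilter_le_nhds (m.map e) hmap
    exact ⟨e₀, he₀⟩
  obtain ⟨e₀, he₀⟩ := hlim hBT e he
  obtain ⟨e₀', he₀'⟩ := hlim hBT' e' he'
  have h0 : Tendsto (fun n => φ n - e n + e' n) m (𝓝 0) := by
    rw [tendsto_zero_iff_norm_tendsto_zero]
    exact squeeze_zero (fun n => norm_nonneg _) hlt
      (tendsto_one_div_add_atTop_nhds_zero_nat.mono_left hm)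
  -- The unit vectors `φ n` inherit norm convergence from `e n - e' n`. Their limit has norm one,
  -- yet it is a fixed point of `(B - B') G₀`, hence zero.
  have hφt : Tendsto φ m (𝓝 (e₀ - e₀')) := by
    have h1 := h0.add (he₀.sub he₀')
    rw [zero_add] at h1
    refine h1.congr fun n => ?_
    abel
  obtain ⟨k, hk, hkt⟩ := h.tendsto_of_mem_graph hBc hBT (hsl.mono_left hm) hφt
    (Eventually.of_forall he)
  obtain ⟨k', hk', hkt'⟩ := h.tendsto_of_mem_graph hBc' hBT' (hsl.mono_left hm) hφt
    (Eventually.of_forall he')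
  have h1 := hinj _ k k' hk hk'
    (by rw [tendsto_nhds_unique hkt he₀, tendsto_nhds_unique hkt' he₀'])
  rw [h1] at hφt
  have h2 := hφt.norm
  simp only [hφ, norm_zero] at h2
  exact one_ne_zero (tendsto_nhds_unique tendsto_const_nhds h2)

end GraphBoundedLimit

end BoundaryLimits

/-! ### Graphs and resolvents of `A + B`. -/

section Resolvents

variable {E X F : Type*}
  [NormedAddCommGroup E] [NormedSpace ℂ E]
  [NormedAddCommGroup X] [NormedSpace ℂ X]
  [NormedAddCommGroup F] [NormedSpace ℂ F]
  {ι : E →L[ℂ] X} {j : X →L[ℂ] F} {hj : Function.Injective j} {A : X →ₗ.[ℂ] X}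
  {B : F →ₗ.[ℂ] E}

theorem mem_graph_hat {u a : X} (h : (u, a) ∈ A.graph) : (j u, j a) ∈ (hat j hj A).graph := by
  refine LinearPMap.le_graph_of_le (LinearPMap.le_closure _) ?_
  rw [LinearPMap.mem_graph_iff] at h ⊢
  obtain ⟨v, hv, hva⟩ := h
  refine ⟨Submodule.equivMapOfInjective (j : X →ₗ[ℂ] F) hj A.domain v, ?_, ?_⟩
  · exact congrArg j hv
  · change j (A.toFun ((Submodule.equivMapOfInjective (j : X →ₗ[ℂ] F) hj A.domain).symm
      (Submodule.equivMapOfInjective (j : X →ₗ[ℂ] F) hj A.domain v))) = j a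
    rw [LinearEquiv.symm_apply_apply]
    exact congrArg j hva

theorem mem_graph_subScalar {T : X →ₗ.[ℂ] X} {z : ℂ} {u w : X} :
    (u, w) ∈ (subScalar T z).graph ↔ (u, w + z • u) ∈ T.graph := by
  simp only [LinearPMap.mem_graph_iff]
  constructor
  · rintro ⟨v, hv, hvw⟩
    refine ⟨v, hv, ?_⟩
    have h1 : T v - z • (v : X) = w := hvw
    rw [← h1, ← hv]
    simp
  · rintro ⟨v, hv, hvw⟩
    refine ⟨v, hv, ?_⟩
    change T v - z • (v : X) = w
    rw [hvw, hv]
    simp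

theorem mem_graph_perturbed {u w : X} :
    (u, w) ∈ (perturbed ι j A B).graph ↔
      ∃ a e, (u, a) ∈ A.graph ∧ (j u, e) ∈ B.graph ∧ w = a + ι e := by
  constructor
  · intro h
    rw [LinearPMap.mem_graph_iff] at h
    obtain ⟨v, hv, hvw⟩ := h
    refine ⟨A ⟨v, v.2.1⟩, B ⟨j v, v.2.2⟩, ?_, ?_, hvw.symm⟩
    · simp only at hv
      rw [← hv]
      exact A.mem_graph ⟨v, v.2.1⟩
    · simp only at hv
      rw [← hv]
      exact B.mem_graph ⟨j v, v.2.2⟩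
  · rintro ⟨a, e, ha, he, rfl⟩
    rw [LinearPMap.mem_graph_iff] at ha he
    obtain ⟨v, hv, hva⟩ := ha
    obtain ⟨b, hb, hbe⟩ := he
    simp only at hv hva hb hbe
    rw [LinearPMap.mem_graph_iff]
    refine ⟨⟨u, ⟨hv ▸ v.2, ?_⟩⟩, rfl, ?_⟩
    · change j u ∈ B.domain
      rw [← hb]
      exact b.2
    · change A ⟨u, _⟩ + ι (B ⟨j u, _⟩) = a + ι e
      congr 2
      · rw [← hva]
        congr 1
        exact Subtype.ext hv.symm
      · rw [← hbe]
        congr 1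
        exact Subtype.ext hb.symm

theorem isBoundedInverse_iff {T : X →ₗ.[ℂ] X} {R : X →L[ℂ] X} :
    IsBoundedInverse T R ↔ (∀ u w, (u, w) ∈ T.graph → R w = u) ∧ ∀ x, (R x, x) ∈ T.graph := by
  constructor
  · rintro ⟨h1, h2⟩
    refine ⟨fun u w h => ?_, fun x => ?_⟩
    · obtain ⟨v, hv, hvw⟩ := T.mem_graph_iff.1 h
      simp only at hv hvw
      rw [← hvw, h1, hv]
    · obtain ⟨u, hu, hux⟩ := h2 x
      exact T.mem_graph_iff.2 ⟨u, hu, hux⟩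
  · rintro ⟨h1, h2⟩
    refine ⟨fun u => h1 _ _ (T.mem_graph u), fun x => ?_⟩
    obtain ⟨u, hu, hux⟩ := T.mem_graph_iff.1 (h2 x)
    exact ⟨u, hu, hux⟩

theorem isBoundedInverse_resolv {T : X →ₗ.[ℂ] X} {z : ℂ} (hz : z ∉ spec T) :
    IsBoundedInverse (subScalar T z) (resolv T z) := by
  have h : ∃ R : X →L[ℂ] X, IsBoundedInverse (subScalar T z) R := not_not.1 hz
  rw [resolv, dif_pos h]
  exact h.choose_spec

theorem resolv_mem_graph {T : X →ₗ.[ℂ] X} {z : ℂ} (hz : z ∉ spec T) (x : X) :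
    (resolv T z x, x + z • resolv T z x) ∈ T.graph :=
  mem_graph_subScalar.1 ((isBoundedInverse_iff.1 (isBoundedInverse_resolv hz)).2 x)

theorem resolv_eq_of_mem_graph {T : X →ₗ.[ℂ] X} {z : ℂ} (hz : z ∉ spec T) {u w : X}
    (h : (u, w + z • u) ∈ T.graph) : resolv T z w = u :=
  (isBoundedInverse_iff.1 (isBoundedInverse_resolv hz)).1 u w (mem_graph_subScalar.2 h)

theorem resolv_perturbed_spec {z : ℂ} (hz : z ∉ spec (perturbed ι j A B)) (x : X) :
    ∃ a e, (resolv (perturbed ι j A B) z x, a) ∈ A.graph ∧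
      (j (resolv (perturbed ι j A B) z x), e) ∈ B.graph ∧
      a + ι e = x + z • resolv (perturbed ι j A B) z x := by
  obtain ⟨a, e, ha, he, h⟩ := mem_graph_perturbed.1 (resolv_mem_graph hz x)
  exact ⟨a, e, ha, he, h.symm⟩

theorem resolv_perturbed_eq {z : ℂ} (hz : z ∉ spec (perturbed ι j A B)) {u a w : X} {e : E}
    (ha : (u, a) ∈ A.graph) (he : (j u, e) ∈ B.graph) (h : a + ι e = w + z • u) :
    resolv (perturbed ι j A B) z w = u :=
  resolv_eq_of_mem_graph hz (mem_graph_perturbed.2 ⟨a, e, ha, he, h.symm⟩)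

end Resolvents

end VirtualLevels

namespace VirtualLevels

/-! ### Resolvent equation and resolvent identity at the boundary point. -/

section BoundaryResolvents

variable {E X F : Type*}
  [NormedAddCommGroup E] [NormedSpace ℂ E]
  [NormedAddCommGroup X] [NormedSpace ℂ X]
  [NormedAddCommGroup F] [NormedSpace ℂ F]

/-- `B̌` is closed and `Â`-compact, the points along `l` are eventually outside of `σ(A + B)`, and
`G` is the limit of `j ∘ (A + B - z)⁻¹ ∘ ι` in the weak operator topology along `l`. -/
structure IsBoundaryResolvent (ι : E →L[ℂ] X) (j : X →L[ℂ] F) (hj : Function.Injective j)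
    (A : X →ₗ.[ℂ] X) (l : Filter ℂ) (B : F →ₗ.[ℂ] E) (G : E →L[ℂ] F) : Prop where
  isClosed : B.IsClosed
  relCompact : RelCompact (hat j hj A) B
  notMem_spec : ∀ᶠ z in l, z ∉ spec (perturbed ι j A B)
  weak : ∀ x, ∀ f : StrongDual ℂ F,
    Tendsto (fun z => f (j (resolv (perturbed ι j A B) z (ι x)))) l (𝓝 (f (G x)))

namespace IsBoundaryResolvent

variable {ι : E →L[ℂ] X} {j : X →L[ℂ] F} {hj : Function.Injective j} {A : X →ₗ.[ℂ] X}
  {l : Filter ℂ} {z₀ : ℂ} {B : F →ₗ.[ℂ] E} {G : E →L[ℂ] F}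

theorem graphBoundedLimit [CompleteSpace E] [l.IsCountablyGenerated]
    (h : IsBoundaryResolvent ι j hj A l B G) (hl : l ≤ 𝓝 z₀) :
    GraphBoundedLimit (hat j hj A) l
      (fun z => j ∘L resolv (perturbed ι j A B) z ∘L ι) G := by
  refine ⟨h.weak, ?_⟩
  obtain ⟨C₁, hC₁⟩ := eventually_norm_le_of_tendsto_weakly
    (G := fun z => j ∘L resolv (perturbed ι j A B) z ∘L ι) (G₀ := G) h.weak
  obtain ⟨C₂, hC₂0, hC₂⟩ := h.relCompact.norm_le h.isClosed (j ∘L ι)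
  set C := max C₁ 0 with hC
  have hC0 : 0 ≤ C := le_max_right _ _
  -- `C` bounds `j u`; the rest bounds `j a` by `norm_le`, since `j a + j ι e = j ι φ + z • j u` and
  -- `‖z‖ < ‖z₀‖ + 1`.
  refine ⟨C + (2 * (‖j ∘L ι‖ + (‖z₀‖ + 1) * C) + C₂ * C), by positivity, ?_⟩
  have hz : ∀ᶠ z : ℂ in l, ‖z‖ < ‖z₀‖ + 1 :=
    hl ((continuous_norm.tendsto z₀).eventually (gt_mem_nhds (lt_add_one _)))
  filter_upwards [h.notMem_spec, hC₁, hz] with z hzs hz1 hz2 φ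
  obtain ⟨a, e, ha, he, hae⟩ := resolv_perturbed_spec hzs (ι φ)
  set u := resolv (perturbed ι j A B) z (ι φ) with hu
  have h1 : ‖j u‖ ≤ C * ‖φ‖ :=
    ((j ∘L resolv (perturbed ι j A B) z ∘L ι).le_opNorm φ).trans
      (by gcongr; exact hz1.trans (le_max_left _ _))
  have h2 : ‖j a + (j ∘L ι) e‖ ≤ (‖j ∘L ι‖ + (‖z₀‖ + 1) * C) * ‖φ‖ := by
    have h3 : j a + (j ∘L ι) e = (j ∘L ι) φ + z • j u := by
      rw [ContinuousLinearMap.comp_apply, ← map_add, hae, map_add, map_smul]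
      rfl
    rw [h3, add_mul]
    refine (norm_add_le _ _).trans (add_le_add ((j ∘L ι).le_opNorm φ) ?_)
    rw [norm_smul, mul_assoc]
    gcongr
  have h3 := hC₂ _ _ _ (mem_graph_hat (hj := hj) ha) he
  refine ⟨j a, mem_graph_hat ha, ?_⟩
  change ‖j u‖ + ‖j a‖ ≤ _
  have h4 := mul_le_mul_of_nonneg_left h1 hC₂0
  linarith

variable [CompleteSpace E] [l.IsCountablyGenerated] [l.NeBot]

/-- For `u = (A + B - z)⁻¹ ι φ` one has `A u = ι (φ - B̌ j u) + z u`. Here `B̌ j u` converges in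
norm and `j u` weakly, and the graph of `Â` is weakly closed. -/
theorem mem_graph (h : IsBoundaryResolvent ι j hj A l B G) (hl : l ≤ 𝓝 z₀)
    (hAF : (transfer j hj A).IsClosable) {φ k : E} (hk : (G φ, k) ∈ B.graph) :
    (G φ, j (ι (φ - k)) + z₀ • G φ) ∈ (hat j hj A).graph := by
  obtain ⟨e₀, he₀, hlim⟩ := (h.graphBoundedLimit hl).exists_tendsto h.isClosed h.relCompact φ
  obtain rfl := B.mem_graph_snd_inj he₀ hk rfl
  have hex : ∀ z, ∃ a e, z ∉ spec (perturbed ι j A B) →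
      (resolv (perturbed ι j A B) z (ι φ), a) ∈ A.graph ∧
      (j (resolv (perturbed ι j A B) z (ι φ)), e) ∈ B.graph ∧
      a + ι e = ι φ + z • resolv (perturbed ι j A B) z (ι φ) := by
    intro z
    by_cases hz : z ∈ spec (perturbed ι j A B)
    · exact ⟨0, 0, fun h => absurd hz h⟩
    · obtain ⟨a, e, H⟩ := resolv_perturbed_spec hz (ι φ)
      exact ⟨a, e, fun _ => H⟩
  choose a e hae using hex
  have hte : Tendsto e l (𝓝 e₀) := hlim e (by
    filter_upwards [h.notMem_spec] with z hz using (hae z hz).2.1)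
  have hcl : IsClosed ((hat j hj A).graph : Set (F × F)) := hAF.closure_isClosed
  refine mem_of_tendsto_weakly hcl (l := l)
    (u := fun z => (j (resolv (perturbed ι j A B) z (ι φ)), j (a z))) ?_ ?_
  · filter_upwards [h.notMem_spec] with z hz using mem_graph_hat (hae z hz).1
  · intro f
    set f₁ : StrongDual ℂ F := f ∘L ContinuousLinearMap.inl ℂ F F with hf₁
    set f₂ : StrongDual ℂ F := f ∘L ContinuousLinearMap.inr ℂ F F with hf₂
    have hf : ∀ a b : F, f (a, b) = f₁ a + f₂ b := fun a b => by
      rw [hf₁, hf₂, ContinuousLinearMap.comp_apply, ContinuousLinearMap.comp_apply, ← map_add]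
      simp
    have h1 := h.weak φ f₁
    have h2 := h.weak φ f₂
    have h3 : Tendsto (fun z => f₂ (j (ι (φ - e z)))) l (𝓝 (f₂ (j (ι (φ - e₀))))) :=
      ((f₂ ∘L j ∘L ι).continuous.tendsto _).comp (tendsto_const_nhds.sub hte)
    have h4 : Tendsto (fun z : ℂ => z) l (𝓝 z₀) := hl
    have h5 := h1.add (h3.add (h4.mul h2))
    simp only [hf, map_add, map_smul, smul_eq_mul]
    refine h5.congr' ?_
    filter_upwards [h.notMem_spec] with z hz
    have h6 : a z = ι (φ - e z) + z • resolv (perturbed ι j A B) z (ι φ) := by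
      rw [map_sub, sub_add_eq_add_sub, ← (hae z hz).2.2, add_sub_cancel_right]
    rw [h6, map_add, map_add, map_smul, map_smul, smul_eq_mul]

theorem injective (h : IsBoundaryResolvent ι j hj A l B G) (hl : l ≤ 𝓝 z₀)
    (hAF : (transfer j hj A).IsClosable) (hι : Function.Injective ι) : Function.Injective G := by
  rw [injective_iff_map_eq_zero]
  intro φ hφ
  have h1 : (G φ, (0 : E)) ∈ B.graph := by rw [hφ]; exact B.graph.zero_mem
  have h2 := h.mem_graph hl hAF h1
  rw [hφ, smul_zero, add_zero, sub_zero] at h2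
  have h3 : j (ι φ) = 0 := LinearPMap.graph_fst_eq_zero_snd _ h2 rfl
  exact (injective_iff_map_eq_zero ι).1 hι _ ((injective_iff_map_eq_zero j).1 hj _ h3)

theorem mem_graph_iff (h : IsBoundaryResolvent ι j hj A l B G) (hl : l ≤ 𝓝 z₀)
    (hAF : (transfer j hj A).IsClosable) (hι : Function.Injective ι) {φ k : E}
    (hk : (G φ, k) ∈ B.graph) : (G φ, z₀ • G φ) ∈ (hat j hj A).graph ↔ φ = k := by
  have h1 := h.mem_graph hl hAF hk
  constructor
  · intro h2
    have h3 := LinearPMap.mem_graph_snd_inj _ h1 h2 rfl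
    rw [add_eq_right] at h3
    exact sub_eq_zero.1
      ((injective_iff_map_eq_zero ι).1 hι _ ((injective_iff_map_eq_zero j).1 hj _ h3))
  · intro h2
    simpa [h2] using h1

/-- The resolvent identity for boundary values. -/
theorem apply_eq {B' : F →ₗ.[ℂ] E} {G' : E →L[ℂ] F} (h : IsBoundaryResolvent ι j hj A l B G)
    (h' : IsBoundaryResolvent ι j hj A l B' G') (hl : l ≤ 𝓝 z₀) {φ e e' : E}
    (he : (G' φ, e) ∈ B.graph) (he' : (G' φ, e') ∈ B'.graph) : G (φ + e - e') = G' φ := by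
  -- Off both spectra, `u = (A + B' - z)⁻¹ ι φ` solves `(A + B - z) u = ι (φ + b - b')`. The zeros
  -- chosen elsewhere are invisible to `l`.
  have hex : ∀ z, ∃ b b', z ∉ spec (perturbed ι j A B) → z ∉ spec (perturbed ι j A B') →
      (j (resolv (perturbed ι j A B') z (ι φ)), b) ∈ B.graph ∧
      (j (resolv (perturbed ι j A B') z (ι φ)), b') ∈ B'.graph ∧
      resolv (perturbed ι j A B) z (ι (φ + b - b')) =
        resolv (perturbed ι j A B') z (ι φ) := by
    intro z
    by_cases hz : z ∈ spec (perturbed ι j A B)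
    · exact ⟨0, 0, fun h => absurd hz h⟩
    by_cases hz' : z ∈ spec (perturbed ι j A B')
    · exact ⟨0, 0, fun _ h => absurd hz' h⟩
    obtain ⟨a, b', ha, hb', hab⟩ := resolv_perturbed_spec hz' (ι φ)
    obtain ⟨b, hb⟩ := h.relCompact.exists_mem_graph (mem_graph_hat (hj := hj) ha)
    refine ⟨b, b', fun _ _ => ⟨hb, hb', resolv_perturbed_eq hz ha hb ?_⟩⟩
    rw [map_sub, map_add, sub_add_eq_add_sub, add_right_comm, ← hab]
    abel
  choose b b' hbb using hex
  have hlim : ∀ {D : F →ₗ.[ℂ] E}, D.IsClosed → RelCompact (hat j hj A) D → ∀ {d : E},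
      (G' φ, d) ∈ D.graph → ∀ e : ℂ → E,
      (∀ᶠ z in l, (j (resolv (perturbed ι j A B') z (ι φ)), e z) ∈ D.graph) →
      Tendsto e l (𝓝 d) := by
    intro D hDc hDT d hd e he
    obtain ⟨e₀, he₀, hlim⟩ := (h'.graphBoundedLimit hl).exists_tendsto hDc hDT φ
    obtain rfl := D.mem_graph_snd_inj he₀ hd rfl
    exact hlim e he
  have h1 : Tendsto b l (𝓝 e) := hlim h.isClosed h.relCompact he b (by
    filter_upwards [h.notMem_spec, h'.notMem_spec] with z hz hz' using (hbb z hz hz').1)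
  have h2 : Tendsto b' l (𝓝 e') := hlim h'.isClosed h'.relCompact he' b' (by
    filter_upwards [h.notMem_spec, h'.notMem_spec] with z hz hz' using (hbb z hz hz').2.1)
  have h3 : Tendsto (fun z => φ + b z - b' z) l (𝓝 (φ + e - e')) :=
    (h1.const_add φ).sub h2
  refine (SeparatingDual.eq_iff_forall_dual_eq (R := ℂ)).2 fun f => ?_
  refine tendsto_nhds_unique ((h.graphBoundedLimit hl).tendsto_apply tendsto_id h3 f) ?_
  refine (h'.weak φ f).congr' ?_
  filter_upwards [h.notMem_spec, h'.notMem_spec] with z hz hz'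
  exact congrArg (fun x => f (j x)) (hbb z hz hz').2.2.symm

theorem range_le {B' : F →ₗ.[ℂ] E} {G' : E →L[ℂ] F} (h : IsBoundaryResolvent ι j hj A l B G)
    (h' : IsBoundaryResolvent ι j hj A l B' G') (hl : l ≤ 𝓝 z₀) :
    LinearMap.range (G' : E →ₗ[ℂ] F) ≤ LinearMap.range (G : E →ₗ[ℂ] F) := by
  rintro _ ⟨φ, rfl⟩
  obtain ⟨e, he, -⟩ := (h'.graphBoundedLimit hl).exists_tendsto h.isClosed h.relCompact φ
  obtain ⟨e', he', -⟩ := (h'.graphBoundedLimit hl).exists_tendsto h'.isClosed h'.relCompact φ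
  exact ⟨_, h.apply_eq h' hl he he'⟩

/-- Since `(A + B - z) ι ψ = ι ((z₀ - z) ψ + k)`, the resolvent reproduces `ι ψ` from arguments
tending to `k`. -/
theorem apply_eq_of_eigenvector (h : IsBoundaryResolvent ι j hj A l B G)
    (hl : l ≤ 𝓝 z₀) {ψ k : E} (hψ : (ι ψ, z₀ • ι ψ) ∈ A.graph)
    (hk : (j (ι ψ), k) ∈ B.graph) : G k = j (ι ψ) := by
  have h4 : Tendsto (fun z : ℂ => (z₀ - z) • ψ + k) l (𝓝 k) := by
    have h1 : Tendsto (fun z : ℂ => z) l (𝓝 z₀) := hl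
    have h2 := ((tendsto_const_nhds (x := z₀)).sub h1).smul_const ψ
    rw [sub_self, zero_smul] at h2
    simpa using h2.add_const k
  refine (SeparatingDual.eq_iff_forall_dual_eq (R := ℂ)).2 fun f => ?_
  refine tendsto_nhds_unique ((h.graphBoundedLimit hl).tendsto_apply tendsto_id h4 f) ?_
  refine tendsto_const_nhds.congr' ?_
  filter_upwards [h.notMem_spec] with z hz
  have h5 : resolv (perturbed ι j A B) z (ι ((z₀ - z) • ψ + k)) = ι ψ := by
    refine resolv_perturbed_eq hz hψ hk ?_
    rw [map_add, map_smul, sub_smul]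
    abel
  exact congrArg (fun x => f (j x)) h5.symm

end IsBoundaryResolvent

theorem mem_nullSpace_subScalar {T : X →ₗ.[ℂ] X} {z : ℂ} {u : X} :
    u ∈ nullSpace (subScalar T z) ↔ (u, z • u) ∈ T.graph := by
  have h1 : u ∈ nullSpace (subScalar T z) ↔ (u, 0) ∈ (subScalar T z).graph := by
    rw [LinearPMap.mem_graph_iff]
    constructor
    · rintro ⟨v, hv, rfl⟩
      exact ⟨v, rfl, hv⟩
    · rintro ⟨v, hv, hv0⟩
      exact ⟨v, hv0, hv⟩
  rw [h1, mem_graph_subScalar, zero_add]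

theorem isBoundaryResolvent_of_mem_regularizing {ι : E →L[ℂ] X} {j : X →L[ℂ] F}
    {hj : Function.Injective j} {A : X →ₗ.[ℂ] X} {Ω : Set ℂ} {z₀ : ℂ} {B : F →ₗ.[ℂ] E}
    (hB : B ∈ regularizing ι j hj A Ω z₀) [(𝓝[Ω] z₀).NeBot] :
    IsBoundaryResolvent ι j hj A (𝓝[Ω] z₀) B
      (boundaryResolv ι j (perturbed ι j A B) Ω z₀) := by
  obtain ⟨h1, h2, -, ⟨δ, hδ, h3⟩, R, hR⟩ := hB
  refine ⟨h1, h2, ?_, ?_⟩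
  · filter_upwards [self_mem_nhdsWithin, mem_nhdsWithin_of_mem_nhds (Metric.ball_mem_nhds z₀ hδ)]
      with z hz hz' hs
    exact Set.disjoint_left.1 h3 ⟨hz, hz'⟩ hs
  · have h4 := ContinuousLinearMapWOT.tendsto_iff_forall_dual_apply_tendsto.1 hR
    rw [boundaryResolv, hR.limUnder_eq]
    exact h4

end BoundaryResolvents

end VirtualLevels

namespace VirtualLevels

/-! ### Finite rank perturbations and their spectrum in `Ω`. -/

section FiniteRank

variable {E X F : Type*}
  [NormedAddCommGroup E] [NormedSpace ℂ E]
  [NormedAddCommGroup X] [NormedSpace ℂ X]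
  [NormedAddCommGroup F] [NormedSpace ℂ F]

theorem exists_biorthogonal {r : ℕ} {v : Fin r → F} (hv : LinearIndependent ℂ v) :
    ∃ f : Fin r → StrongDual ℂ F, ∀ i k, f i (v k) = if i = k then 1 else 0 := by
  let b := Module.Basis.span hv
  have : FiniteDimensional ℂ (Submodule.span ℂ (Set.range v)) := b.finiteDimensional_of_finite
  choose f hf using fun i => exists_extension_norm_eq (Submodule.span ℂ (Set.range v))
    (LinearMap.toContinuousLinearMap (b.coord i))
  refine ⟨f, fun i k => ?_⟩
  have h1 : ((b k : Submodule.span ℂ (Set.range v)) : F) = v k :=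
    congrArg Subtype.val (Module.Basis.span_apply hv k)
  rw [← h1, (hf i).1]
  simp [Finsupp.single_apply, eq_comm]

/-- The bounded operator `∑ i, f i (·) • a i` as a partially defined operator. -/
noncomputable def finiteRankPMap {r : ℕ} (f : Fin r → StrongDual ℂ F) (a : Fin r → E) :
    F →ₗ.[ℂ] E :=
  ((∑ i, (f i).smulRight (a i) : F →L[ℂ] E) : F →ₗ[ℂ] E).toPMap ⊤

variable {r : ℕ} {f : Fin r → StrongDual ℂ F} {a : Fin r → E}

theorem mem_graph_finiteRankPMap {ψ : F} {e : E} :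
    (ψ, e) ∈ (finiteRankPMap f a).graph ↔ e = ∑ i, f i ψ • a i := by
  rw [LinearPMap.mem_graph_iff]
  constructor
  · rintro ⟨v, hv, hve⟩
    have h1 : (∑ i, (f i).smulRight (a i) : F →L[ℂ] E) v = e := hve
    have h2 : (v : F) = ψ := hv
    rw [← h1, h2]
    simp
  · rintro rfl
    refine ⟨⟨ψ, trivial⟩, rfl, ?_⟩
    change (∑ i, (f i).smulRight (a i) : F →L[ℂ] E) ψ = _
    simp

theorem isClosed_finiteRankPMap : (finiteRankPMap f a).IsClosed := by
  have h1 : ((finiteRankPMap f a).graph : Set (F × E)) =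
      {p | p.2 = ∑ i, f i p.1 • a i} := by
    ext ⟨ψ, e⟩
    exact mem_graph_finiteRankPMap
  rw [LinearPMap.IsClosed, h1]
  exact isClosed_eq continuous_snd (by fun_prop)

theorem relCompact_finiteRankPMap (T : F →ₗ.[ℂ] F) : RelCompact T (finiteRankPMap f a) := by
  refine ⟨le_top, ?_⟩
  have h1 : IsCompactOperator (∑ i, (f i).smulRight (a i) : F →L[ℂ] E) :=
    isCompactOperator_sum_smulRight f a
  refine (h1.isCompact_closure_image_ball 1).of_isClosed_subset isClosed_closure
    (closure_mono ?_)
  rintro _ ⟨ψ, hψ, rfl⟩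
  refine ⟨ψ, ?_, rfl⟩
  rw [mem_ball_zero_iff]
  linarith [norm_nonneg (T ψ)]

theorem opRank_finiteRankPMap_le : opRank (finiteRankPMap f a) ≤ r := by
  have h1 : LinearMap.range (finiteRankPMap f a).toFun ≤ Submodule.span ℂ (Set.range a) := by
    rintro _ ⟨ψ, rfl⟩
    have h2 := mem_graph_finiteRankPMap.1 ((finiteRankPMap f a).mem_graph ψ)
    change finiteRankPMap f a ψ ∈ _
    rw [h2]
    exact Submodule.sum_mem _ fun i _ =>
      Submodule.smul_mem _ _ (Submodule.subset_span ⟨i, rfl⟩)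
  have h2 := Submodule.rank_mono h1
  have h3 : Module.rank ℂ (Submodule.span ℂ (Set.range a)) ≤ r := by
    have h4 : Module.Finite ℂ (Submodule.span ℂ (Set.range a)) :=
      Module.Finite.span_of_finite ℂ (Set.finite_range a)
    rw [← Module.finrank_eq_rank]
    have := finrank_range_le_card (R := ℂ) a
    rw [Set.finrank, Fintype.card_fin] at this
    exact_mod_cast this
  exact h2.trans h3

variable {ι : E →L[ℂ] X} {j : X →L[ℂ] F} {A : X →ₗ.[ℂ] X} {z : ℂ}

theorem mem_graph_perturbed_finiteRankPMap {u w : X} :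
    (u, w) ∈ (perturbed ι j A (finiteRankPMap f a)).graph ↔
      ∃ b, (u, b) ∈ A.graph ∧ w = b + ∑ i, f i (j u) • ι (a i) := by
  rw [mem_graph_perturbed]
  constructor
  · rintro ⟨b, e, hb, he, rfl⟩
    refine ⟨b, hb, ?_⟩
    rw [mem_graph_finiteRankPMap.1 he]
    simp
  · rintro ⟨b, hb, rfl⟩
    exact ⟨b, _, hb, mem_graph_finiteRankPMap.2 rfl, by simp⟩

theorem eq_zero_of_resolv_eq_zero {T : X →ₗ.[ℂ] X} (hz : z ∉ spec T) {x : X}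
    (h : resolv T z x = 0) : x = 0 := by
  have h1 := resolv_mem_graph hz x
  rw [h, smul_zero, add_zero] at h1
  exact T.graph_fst_eq_zero_snd h1 rfl

/-- `(A + C - z) (A - z)⁻¹ = 1 + C (A - z)⁻¹` with `C` of finite rank, so the Fredholm alternative
upgrades injectivity to invertibility. -/
theorem notMem_spec_perturbed_of_injective [CompleteSpace X] (hz : z ∉ spec A)
    (hinj : ∀ u b, (u, b) ∈ A.graph → b + ∑ i, f i (j u) • ι (a i) = z • u → u = 0) :
    z ∉ spec (perturbed ι j A (finiteRankPMap f a)) := by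
  set C : X →L[ℂ] X := ∑ i, ((f i) ∘L j).smulRight (ι (a i)) with hC
  have hCu : ∀ u, C u = ∑ i, f i (j u) • ι (a i) := fun u => by simp [hC]
  have hCc : IsCompactOperator C := isCompactOperator_sum_smulRight (fun i => f i ∘L j)
    (fun i => ι (a i))
  set R := resolv A z with hR
  have hN : ∀ x, (1 - (-(C ∘L R)) : X →L[ℂ] X) x = x + C (R x) := fun x => by simp
  have hb : Function.Bijective (1 - (-(C ∘L R)) : X →L[ℂ] X) := by
    refine bijective_one_sub_of_injective (hCc.comp_clm R).neg fun x hx => ?_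
    refine eq_zero_of_resolv_eq_zero hz (hinj _ _ (resolv_mem_graph hz x) ?_)
    have h1 : x + C (R x) = 0 := by
      nth_rw 1 [hx]
      simp
    rw [← hCu, add_right_comm]
    change x + C (R x) + z • R x = z • R x
    rw [h1, zero_add]
  let S := ContinuousLinearEquiv.ofBijective (1 - (-(C ∘L R)) : X →L[ℂ] X)
    (LinearMap.ker_eq_bot.2 hb.1) (LinearMap.range_eq_top.2 hb.2)
  have hS : ∀ x, S x = x + C (R x) := hN
  refine not_not.2 ⟨R ∘L (S.symm : X →L[ℂ] X), isBoundedInverse_iff.2 ⟨fun u w h => ?_, fun x => ?_⟩⟩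
  · obtain ⟨b, hb, hw⟩ := mem_graph_perturbed_finiteRankPMap.1 (mem_graph_subScalar.1 h)
    have h1 : R (b - z • u) = u := resolv_eq_of_mem_graph hz (by simpa using hb)
    have h2 : S (b - z • u) = w := by
      rw [hS, h1, hCu, sub_add_eq_add_sub, ← hw, add_sub_cancel_right]
    rw [← h2]
    simpa using h1
  · obtain ⟨y, rfl⟩ := S.surjective x
    refine mem_graph_subScalar.2 (mem_graph_perturbed_finiteRankPMap.2
      ⟨y + z • R y, ?_, ?_⟩)
    · simpa using resolv_mem_graph hz y
    · rw [hS, ← hCu]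
      simp only [ContinuousLinearMap.comp_apply, ContinuousLinearEquiv.coe_coe]
      rw [← hS, S.symm_apply_apply, hS]
      abel

theorem isFredholmOp_perturbed_finiteRankPMap [CompleteSpace X] (hz : z ∉ spec A) :
    IsFredholmOp (subScalar (perturbed ι j A (finiteRankPMap f a)) z) := by
  set T := subScalar (perturbed ι j A (finiteRankPMap f a)) z with hT
  have hTg : ∀ {u w : X}, (u, w) ∈ T.graph ↔
      ∃ b, (u, b) ∈ A.graph ∧ w + z • u = b + ∑ i, f i (j u) • ι (a i) := by
    intro u w
    rw [hT, mem_graph_subScalar, mem_graph_perturbed_finiteRankPMap]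
  let Λ : X →L[ℂ] (Fin r → ℂ) :=
    ContinuousLinearMap.pi (fun i => f i ∘L j ∘L resolv A z)
  let D : Submodule ℂ X := LinearMap.ker (Λ : X →ₗ[ℂ] (Fin r → ℂ))
  have hDc : IsClosed (D : Set X) := Λ.isClosed_ker
  have hDf : FiniteDimensional ℂ (X ⧸ D) :=
    Module.Finite.equiv (Λ : X →ₗ[ℂ] (Fin r → ℂ)).quotKerEquivRange.symm
  -- On `D` the perturbation does not act on `(A - z)⁻¹ x`, so the closed finite-codimensional `D`
  -- lies in the range.
  have hD : D ≤ LinearMap.range T.toFun := by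
    intro x hx
    have h1 : ∀ i, f i (j (resolv A z x)) = 0 := fun i => congrFun (LinearMap.mem_ker.1 hx) i
    have h2 : (resolv A z x, x) ∈ T.graph :=
      hTg.2 ⟨_, resolv_mem_graph hz x, by simp [h1]⟩
    obtain ⟨v, -, hv⟩ := T.mem_graph_iff.1 h2
    exact ⟨v, hv⟩
  refine ⟨?_, Submodule.isClosed_mono_of_finiteDimensional_quotient hDc hD,
    Module.Finite.of_surjective _ (Submodule.factor_surjective hD)⟩
  let Φ : LinearMap.ker T.toFun →ₗ[ℂ] (Fin r → ℂ) :=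
    (LinearMap.pi (fun i => ((f i ∘L j : X →L[ℂ] ℂ) : X →ₗ[ℂ] ℂ))) ∘ₗ T.domain.subtype ∘ₗ
      (LinearMap.ker T.toFun).subtype
  -- A null vector on which all `f i ∘ j` vanish is a null vector of `A - z`, hence zero.
  refine FiniteDimensional.of_injective Φ ((injective_iff_map_eq_zero Φ).2 fun v hv => ?_)
  have h1 : ∀ i, f i (j ((v : T.domain) : X)) = 0 := fun i => congrFun hv i
  have h2 : (((v : T.domain) : X), (0 : X)) ∈ T.graph :=
    T.mem_graph_iff.2 ⟨v, rfl, LinearMap.mem_ker.1 v.2⟩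
  obtain ⟨b, hb, hb'⟩ := hTg.1 h2
  have h3 : b = z • ((v : T.domain) : X) := by simpa [h1] using hb'.symm
  have h4 : resolv A z 0 = ((v : T.domain) : X) :=
    resolv_eq_of_mem_graph hz (by rwa [zero_add, ← h3])
  rw [map_zero] at h4
  exact Subtype.ext (Subtype.ext h4.symm)

/-- The determinant whose zeros outside of `σ(A)` are the points of the spectrum of the finite
rank perturbation of `A`. -/
noncomputable def perturbationDet (ι : E →L[ℂ] X) (j : X →L[ℂ] F) (A : X →ₗ.[ℂ] X)
    (f : Fin r → StrongDual ℂ F) (a : Fin r → E) (z : ℂ) : ℂ :=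
  (1 + Matrix.of fun k i => f k (j (resolv A z (ι (a i)))) : Matrix (Fin r) (Fin r) ℂ).det

/-- A null vector `u` of the perturbed operator satisfies `u = -(A - z)⁻¹ ∑ c i ι (a i)` with `c i =
f i (j u)`. Applying the functionals `f k ∘ j` makes `c` a null vector of the matrix, and the step
is reversible. -/
theorem notMem_spec_iff_perturbationDet_ne_zero [CompleteSpace X] (hz : z ∉ spec A) :
    z ∉ spec (perturbed ι j A (finiteRankPMap f a)) ↔ perturbationDet ι j A f a z ≠ 0 := by
  set M : Matrix (Fin r) (Fin r) ℂ := 1 + Matrix.of fun k i => f k (j (resolv A z (ι (a i))))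
    with hM
  have hMc : ∀ (c : Fin r → ℂ) k, M.mulVec c k =
      c k + f k (j (resolv A z (∑ i, c i • ι (a i)))) := fun c k => by
    rw [hM, Matrix.add_mulVec, Matrix.one_mulVec]
    simp [Matrix.mulVec, dotProduct, mul_comm]
  constructor
  · intro hs h0
    obtain ⟨c, hc0, hc⟩ := Matrix.exists_mulVec_eq_zero_iff.2 h0
    set u := resolv A z (-∑ i, c i • ι (a i)) with hu
    have h1 : ∀ k, f k (j u) = c k := fun k => by
      have h2 := congrFun hc k
      rw [hMc] at h2
      rw [hu, map_neg, map_neg, map_neg]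
      exact (eq_neg_of_add_eq_zero_left h2).symm
    have h2 : (u, 0 + z • u) ∈ (perturbed ι j A (finiteRankPMap f a)).graph := by
      refine mem_graph_perturbed_finiteRankPMap.2 ⟨_, resolv_mem_graph hz _, ?_⟩
      simp only [← hu, h1]
      abel
    have h3 : u = 0 := by rw [← resolv_eq_of_mem_graph hs h2, map_zero]
    apply hc0
    funext k
    rw [← h1, h3]
    simp
  · intro hdet
    refine notMem_spec_perturbed_of_injective hz fun u b hub hb => ?_
    set x := ∑ i, f i (j u) • ι (a i) with hx
    have h1 : resolv A z (-x) = u := resolv_eq_of_mem_graph hz (by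
      have : -x + z • u = b := by rw [← hb]; abel
      rwa [this])
    have h2 : M.mulVec (fun k => f k (j u)) = 0 := by
      funext k
      rw [hMc, ← hx]
      nth_rw 1 [← h1]
      simp
    have h3 : (fun k => f k (j u)) = 0 := by
      by_contra h3
      exact hdet (Matrix.exists_mulVec_eq_zero_iff.1 ⟨_, h3, h2⟩)
    have h4 : x = 0 := by
      rw [hx]
      exact Finset.sum_eq_zero fun i _ => by rw [congrFun h3 i]; simp
    rw [← h1, h4, neg_zero, map_zero]

/-- Near `w` the resolvent is `R (1 - (z - w) R)⁻¹` with `R = resolv A w`. -/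
theorem differentiableAt_resolv [CompleteSpace X] {w : ℂ} (hw : ∀ᶠ z in 𝓝 w, z ∉ spec A) :
    DifferentiableAt ℂ (resolv A) w := by
  set R := resolv A w with hR
  let g : ℂ → X →L[ℂ] X := fun z => 1 - (z - w) • R
  have hg : DifferentiableAt ℂ g w := by
    simp only [g]
    fun_prop
  have hgw : g w = ((1 : (X →L[ℂ] X)ˣ) : X →L[ℂ] X) := by simp [g]
  have h1 : DifferentiableAt ℂ (fun z => R * Ring.inverse (g z)) w := by
    have h2 : DifferentiableAt ℂ Ring.inverse (g w) :=
      differentiableAt_inverse (hgw ▸ Units.isUnit 1)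
    exact (differentiableAt_const R).mul (h2.comp w hg)
  refine h1.congr_of_eventuallyEq ?_
  have h2 : ∀ᶠ z in 𝓝 w, IsUnit (g z) := by
    refine hg.continuousAt.eventually (p := IsUnit) ?_
    rw [hgw]
    exact Units.isOpen.mem_nhds (Units.isUnit 1)
  filter_upwards [hw, h2] with z hz hu
  have h3 : resolv A z * g z = R := by
    ext x
    refine resolv_eq_of_mem_graph hz ?_
    have h4 := resolv_mem_graph hw.self_of_nhds x
    have h5 : g z x + z • R x = x + w • R x := by
      simp only [g, sub_apply, one_apply_eq_self, smul_apply, sub_smul]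
      abel
    change (R x, g z x + z • R x) ∈ A.graph
    rwa [h5]
  rw [← h3, mul_assoc, Ring.mul_inverse_cancel _ hu, mul_one]

/-- The determinant is analytic on the connected `Ω` and nonzero at `z₁`, so its zeros are isolated;
Fredholmness at them is automatic. -/
theorem disjoint_essSpec_perturbed [CompleteSpace X] {Ω : Set ℂ} (hΩo : IsOpen Ω)
    (hΩc : IsPreconnected Ω) (hΩ : Disjoint Ω (spec A)) {z₁ : ℂ} (hz₁ : z₁ ∈ Ω)
    (hs : z₁ ∉ spec (perturbed ι j A (finiteRankPMap f a))) :
    Disjoint Ω (essSpec (perturbed ι j A (finiteRankPMap f a))) := by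
  have hΩs : ∀ z ∈ Ω, z ∉ spec A := fun z hz => Set.disjoint_left.1 hΩ hz
  have hd : DifferentiableOn ℂ (perturbationDet ι j A f a) Ω := by
    intro z hz
    refine DifferentiableAt.differentiableWithinAt ?_
    have h1 : DifferentiableAt ℂ (resolv A) z :=
      differentiableAt_resolv (by filter_upwards [hΩo.mem_nhds hz] with w hw using hΩs w hw)
    have h2 : ∀ k i, DifferentiableAt ℂ (fun z =>
        (1 + Matrix.of fun k i => f k (j (resolv A z (ι (a i)))) : Matrix (Fin r) (Fin r) ℂ) k i)
        z := by
      intro k i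
      simp only [Matrix.add_apply, Matrix.of_apply]
      refine (differentiableAt_const _).add ?_
      exact (f k ∘L j).differentiableAt.comp z (h1.clm_apply (differentiableAt_const _))
    have h3 : perturbationDet ι j A f a = fun z => ∑ σ : Equiv.Perm (Fin r),
        Equiv.Perm.sign σ • ∏ i, (1 + Matrix.of fun k i => f k (j (resolv A z (ι (a i)))) :
          Matrix (Fin r) (Fin r) ℂ) (σ i) i := funext fun z => Matrix.det_apply _
    rw [h3]
    exact DifferentiableAt.fun_sum fun σ _ =>
      (DifferentiableAt.fun_finsetProd fun i _ => h2 (σ i) i).const_smul _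
  have ha := hd.analyticOnNhd hΩo
  rw [Set.disjoint_left]
  rintro z hz ⟨hzs, hzd⟩
  refine hzd ⟨hzs, ?_, isFredholmOp_perturbed_finiteRankPMap (hΩs z hz)⟩
  by_contra hf
  have h1 : ∃ᶠ w in 𝓝[≠] z, perturbationDet ι j A f a w = 0 := by
    have h2 : ∀ᶠ w in 𝓝[≠] z, w ∈ Ω := mem_nhdsWithin_of_mem_nhds (hΩo.mem_nhds hz)
    refine ((not_eventually.1 hf).and_eventually h2).mono fun w hw => ?_
    by_contra h3
    exact hw.1 ((notMem_spec_iff_perturbationDet_ne_zero (hΩs w hw.2)).2 h3)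
  have h2 := ha.eqOn_zero_of_preconnected_of_frequently_eq_zero hΩc hz h1
  exact (notMem_spec_iff_perturbationDet_ne_zero (hΩs z₁ hz₁)).1 hs (h2 hz₁)

end FiniteRank

end VirtualLevels

namespace VirtualLevels

/-! ### A regularizing perturbation of minimal rank. -/

section MinimalRank

variable {E X F : Type*}
  [NormedAddCommGroup E] [NormedSpace ℂ E] [CompleteSpace E]
  [NormedAddCommGroup X] [NormedSpace ℂ X] [CompleteSpace X]
  [NormedAddCommGroup F] [NormedSpace ℂ F]
  {ι : E →L[ℂ] X} {j : X →L[ℂ] F} {hj : Function.Injective j} {A : X →ₗ.[ℂ] X}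
  {z₀ : ℂ} {B : F →ₗ.[ℂ] E} {G : E →L[ℂ] F} {K : E →L[ℂ] E}
  {r : ℕ} {f : Fin r → StrongDual ℂ F} {a : Fin r → E}

/-- If `1 - K + P ∘ G` is injective for a finite rank operator `P`, then the resolvents of the
perturbation of `A` by `P` have boundary values in the weak operator topology. -/
theorem IsBoundaryResolvent.exists_of_finiteRank {l : Filter ℂ} [l.IsCountablyGenerated] [l.NeBot]
    (h : IsBoundaryResolvent ι j hj A l B G) (hl : l ≤ 𝓝 z₀) (hA : ∀ᶠ z in l, z ∉ spec A)
    (hK : IsCompactOperator K) (hKB : ∀ φ, (G φ, K φ) ∈ B.graph)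
    (hinj : ∀ x, x - K x + ∑ i, f i (G x) • a i = 0 → x = 0) :
    ∃ G', IsBoundaryResolvent ι j hj A l (finiteRankPMap f a) G' := by
  have hG := h.graphBoundedLimit hl
  set P : F →L[ℂ] E := ∑ i, (f i).smulRight (a i) with hP
  have hPx : ∀ ψ, P ψ = ∑ i, f i ψ • a i := fun ψ => by simp [hP]
  have hPg : ∀ {ψ : F} {e : E}, (ψ, e) ∈ (finiteRankPMap f a).graph ↔ e = P ψ := fun {ψ e} => by
    rw [hPx]
    exact mem_graph_finiteRankPMap
  have hPc : IsCompactOperator P := isCompactOperator_sum_smulRight f a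
  have hrel : RelCompact (hat j hj A) (finiteRankPMap f a) := relCompact_finiteRankPMap _
  have hbij : Function.Bijective (1 - (K - P ∘L G) : E →L[ℂ] E) := by
    refine bijective_one_sub_of_injective (hK.sub (hPc.comp_clm G)) fun x hx => hinj x ?_
    have h1 : x = K x - P (G x) := hx
    rw [← hPx]
    nth_rw 1 [h1]
    abel
  obtain ⟨δ, hδ, hbound⟩ := hG.eventually_bounded_below h.isClosed h.relCompact
    isClosed_finiteRankPMap hrel (fun φ k k' hk hk' hφ => hinj φ (by
      rw [← B.mem_graph_snd_inj hk (hKB φ) rfl, ← hPx, ← hPg.1 hk']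
      nth_rw 1 [hφ]
      abel))
  have hspec : ∀ᶠ z in l, z ∉ spec (perturbed ι j A (finiteRankPMap f a)) := by
    filter_upwards [hA, h.notMem_spec, hbound] with z hzA hzB hz
    refine notMem_spec_perturbed_of_injective hzA fun u b hub hb => ?_
    obtain ⟨e, he⟩ := h.relCompact.exists_mem_graph (mem_graph_hat (hj := hj) hub)
    -- A null vector of `A + P - z` comes from `x = e - P (j u)`, for which the operator bounded
    -- below gives `x - e + P (j u) = 0`.
    have h1 : resolv (perturbed ι j A B) z (ι (e - P (j u))) = u := by
      refine resolv_perturbed_eq hzB hub he ?_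
      rw [← hb, map_sub, hPx]
      simp only [map_sum, map_smul]
      abel
    have h2 : (j ∘L resolv (perturbed ι j A B) z ∘L ι) (e - P (j u)) = j u :=
      congrArg j h1
    have h3 := hz (e - P (j u)) e (P (j u)) (by rwa [h2]) (by rw [h2]; exact hPg.2 rfl)
    have h4 : e - P (j u) = 0 := by
      rw [show e - P (j u) - e + P (j u) = 0 by abel, norm_zero] at h3
      exact norm_eq_zero.1 (le_antisymm (nonpos_of_mul_nonpos_right h3 hδ) (norm_nonneg _))
    rw [← h1, h4, map_zero, map_zero]
  let S := ContinuousLinearEquiv.ofBijective (1 - (K - P ∘L G) : E →L[ℂ] E)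
    (LinearMap.ker_eq_bot.2 hbij.1) (LinearMap.range_eq_top.2 hbij.2)
  refine ⟨G ∘L (S.symm : E →L[ℂ] E), isClosed_finiteRankPMap, hrel, hspec, fun x g => ?_⟩
  set ε := S.symm x with hε
  have hSε : ε - K ε + P (G ε) = x := by
    have h1 : S ε = x := S.apply_symm_apply x
    have h2 : S ε = ε - (K ε - P (G ε)) := rfl
    rw [← h1, h2]
    abel
  have hex : ∀ z, ∃ b c, z ∉ spec (perturbed ι j A B) →
      z ∉ spec (perturbed ι j A (finiteRankPMap f a)) →
      (j (resolv (perturbed ι j A (finiteRankPMap f a)) z (ι x)), b) ∈ B.graph ∧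
      resolv (perturbed ι j A B) z (ι (x + b -
        P (j (resolv (perturbed ι j A (finiteRankPMap f a)) z (ι x))))) =
        resolv (perturbed ι j A (finiteRankPMap f a)) z (ι x) ∧
      (j (resolv (perturbed ι j A B) z (ι ε)), c) ∈ B.graph := by
    intro z
    by_cases hz : z ∈ spec (perturbed ι j A B)
    · exact ⟨0, 0, fun h => absurd hz h⟩
    by_cases hz' : z ∈ spec (perturbed ι j A (finiteRankPMap f a))
    · exact ⟨0, 0, fun _ h => absurd hz' h⟩
    obtain ⟨v, e, hv, he, hve⟩ := resolv_perturbed_spec hz' (ι x)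
    obtain ⟨b, hb⟩ := h.relCompact.exists_mem_graph (mem_graph_hat (hj := hj) hv)
    obtain ⟨v', c, -, hc, -⟩ := resolv_perturbed_spec hz (ι ε)
    refine ⟨b, c, fun _ _ => ⟨hb, resolv_perturbed_eq hz hv hb ?_, hc⟩⟩
    rw [← hPg.1 he, map_sub, map_add, sub_add_eq_add_sub, add_right_comm, ← hve]
    abel
  choose b c hbc using hex
  obtain ⟨k, hk, hkt⟩ := hG.exists_tendsto h.isClosed h.relCompact ε
  have hc : Tendsto c l (𝓝 (K ε)) := by
    rw [← B.mem_graph_snd_inj hk (hKB ε) rfl]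
    refine hkt c ?_
    filter_upwards [h.notMem_spec, hspec] with z hz hz' using (hbc z hz hz').2.2
  obtain ⟨k', hk', hkt'⟩ := hG.exists_tendsto isClosed_finiteRankPMap hrel ε
  have hp : Tendsto (fun z => P (j (resolv (perturbed ι j A B) z (ι ε)))) l (𝓝 (P (G ε))) := by
    rw [← hPg.1 hk']
    exact hkt' _ (Eventually.of_forall fun z => hPg.2 rfl)
  -- `η z` solves the regularized equation at `z` with right side `x`, and `ε` solves it in the
  -- limit. The lower bound applied to `η z - ε` gives `η z → ε`, whence the limit `G ε`.
  set η : ℂ → E := fun z => x + b z -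
    P (j (resolv (perturbed ι j A (finiteRankPMap f a)) z (ι x))) with hη
  have hη_le : ∀ᶠ z in l, ‖η z - ε‖ ≤
      δ⁻¹ * ‖x - (ε - c z + P (j (resolv (perturbed ι j A B) z (ι ε))))‖ := by
    filter_upwards [h.notMem_spec, hspec, hbound] with z hz hz' hzb
    obtain ⟨h1, h2, h3⟩ := hbc z hz hz'
    have h4 : (j ∘L resolv (perturbed ι j A B) z ∘L ι) (η z - ε) =
        j (resolv (perturbed ι j A (finiteRankPMap f a)) z (ι x)) -
          j (resolv (perturbed ι j A B) z (ι ε)) := by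
      rw [map_sub]
      exact congrArg (fun u => j u - _) h2
    have h5 := hzb (η z - ε) (b z - c z)
      (P (j (resolv (perturbed ι j A (finiteRankPMap f a)) z (ι x))) -
        P (j (resolv (perturbed ι j A B) z (ι ε))))
      (by rw [h4]; exact B.graph.sub_mem h1 h3) (by rw [h4, hPg, map_sub])
    rw [le_inv_mul_iff₀ hδ]
    refine h5.trans_eq (congrArg _ ?_)
    simp only [hη]
    abel
  have hηt : Tendsto η l (𝓝 ε) := by
    rw [tendsto_iff_norm_sub_tendsto_zero]
    refine squeeze_zero' (Eventually.of_forall fun z => norm_nonneg _) hη_le ?_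
    have h1 := (((hc.const_sub ε).add hp).const_sub x).norm.const_mul δ⁻¹
    rwa [hSε, sub_self, norm_zero, mul_zero] at h1
  refine (hG.tendsto_apply tendsto_id hηt g).congr' ?_
  filter_upwards [h.notMem_spec, hspec] with z hz hz'
  exact congrArg (fun u => g (j u)) (hbc z hz hz').2.1

omit [CompleteSpace E] in
theorem mem_regularizing_finiteRankPMap {Ω : Set ℂ} (hΩo : IsOpen Ω) (hΩc : IsPreconnected Ω)
    (hΩ : Disjoint Ω (spec A)) [(𝓝[Ω] z₀).NeBot]
    (h : IsBoundaryResolvent ι j hj A (𝓝[Ω] z₀) (finiteRankPMap f a) G) :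
    finiteRankPMap f a ∈ regularizing ι j hj A Ω z₀ := by
  refine ⟨h.isClosed, h.relCompact, ?_, ?_, ContinuousLinearMapWOT.ofCLM G, ?_⟩
  · obtain ⟨z₁, hz₁, hz₁Ω⟩ := (h.notMem_spec.and self_mem_nhdsWithin).exists
    exact disjoint_essSpec_perturbed hΩo hΩc hΩ hz₁Ω hz₁
  · obtain ⟨δ, hδ, hs⟩ := Metric.mem_nhdsWithin_iff.1 h.notMem_spec
    exact ⟨δ, hδ, Set.disjoint_left.2 fun z hz hzs => hs ⟨hz.2, hz.1⟩ hzs⟩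
  · exact ContinuousLinearMapWOT.tendsto_iff_forall_dual_apply_tendsto.2 h.weak

/-- Injectivity of `G` keeps the images of a basis of `ker (1 - K)` independent, so functionals on
`F` biorthogonal to them exist and the correction has the form `P ∘ G`. -/
theorem exists_finiteRank_mem_regularizing {Ω : Set ℂ} (hΩo : IsOpen Ω) (hΩc : IsPreconnected Ω)
    (hΩ : Disjoint Ω (spec A)) [(𝓝[Ω] z₀).NeBot]
    (h : IsBoundaryResolvent ι j hj A (𝓝[Ω] z₀) B G) (hG : Function.Injective G)
    (hK : IsCompactOperator K) (hKB : ∀ φ, (G φ, K φ) ∈ B.graph) :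
    ∃ B' ∈ regularizing ι j hj A Ω z₀,
      opRank B' ≤ (Module.finrank ℂ (LinearMap.ker ((1 - K : E →L[ℂ] E) : E →ₗ[ℂ] E)) : ℕ) := by
  have hfin := finiteDimensional_ker_one_sub hK
  let φ := Module.finBasis ℂ (LinearMap.ker ((1 - K : E →L[ℂ] E) : E →ₗ[ℂ] E))
  have hv : LinearIndependent ℂ (fun i => G (φ i : E)) := by
    have h1 : LinearIndependent ℂ (fun i => (φ i : E)) :=
      φ.linearIndependent.map' (Submodule.subtype _) (Submodule.ker_subtype _)
    exact h1.map' (G : E →ₗ[ℂ] F) (LinearMap.ker_eq_bot.2 hG)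
  obtain ⟨f, hf⟩ := exists_biorthogonal hv
  obtain ⟨a, ha⟩ := exists_finiteRank_correction hK rfl φ (fun i => f i ∘L G) hf
  obtain ⟨G', hG'⟩ := h.exists_of_finiteRank (f := f) (a := a) nhdsWithin_le_nhds
    (by filter_upwards [self_mem_nhdsWithin] with z hz using Set.disjoint_left.1 hΩ hz) hK hKB ha
  exact ⟨_, mem_regularizing_finiteRankPMap hΩo hΩc hΩ hG', opRank_finiteRankPMap_le⟩

end MinimalRank

/-! ### Virtual states as the image of `ker (1 - K)`. -/

section VirtualStates

variable {E X F : Type*}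
  [NormedAddCommGroup E] [NormedSpace ℂ E]
  [NormedAddCommGroup X] [NormedSpace ℂ X]
  [NormedAddCommGroup F] [NormedSpace ℂ F]
  {ι : E →L[ℂ] X} {j : X →L[ℂ] F} {hj : Function.Injective j} {A : X →ₗ.[ℂ] X}
  {Ω : Set ℂ} {z₀ : ℂ} {B : F →ₗ.[ℂ] E} {K : E →L[ℂ] E}

theorem birmanSchwinger_domain_eq_top
    (hKB : ∀ φ, (boundaryResolv ι j (perturbed ι j A B) Ω z₀ φ, K φ) ∈ B.graph) :
    (birmanSchwinger ι j A Ω z₀ B).domain = ⊤ :=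
  Submodule.eq_top_iff'.2 fun φ => show _ ∈ B.domain from
    LinearPMap.mem_domain_of_mem_graph (hKB φ)

theorem oneSub_birmanSchwinger_apply
    (hKB : ∀ φ, (boundaryResolv ι j (perturbed ι j A B) Ω z₀ φ, K φ) ∈ B.graph)
    (u : (oneSub (birmanSchwinger ι j A Ω z₀ B)).domain) :
    oneSub (birmanSchwinger ι j A Ω z₀ B) u = u - K u :=
  congrArg (fun e => (u : E) - e) (B.mem_graph_snd_inj (B.mem_graph ⟨_, u.2⟩) (hKB u) rfl)

theorem nullSpace_oneSub_birmanSchwinger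
    (hKB : ∀ φ, (boundaryResolv ι j (perturbed ι j A B) Ω z₀ φ, K φ) ∈ B.graph) :
    nullSpace (oneSub (birmanSchwinger ι j A Ω z₀ B)) =
      LinearMap.ker ((1 - K : E →L[ℂ] E) : E →ₗ[ℂ] E) := by
  ext φ
  constructor
  · rintro ⟨v, hv, rfl⟩
    exact (oneSub_birmanSchwinger_apply hKB v).symm.trans hv
  · intro hφ
    have h1 : φ - K φ = 0 := hφ
    have h2 : φ ∈ (birmanSchwinger ι j A Ω z₀ B).domain := by
      rw [birmanSchwinger_domain_eq_top hKB]
      trivial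
    exact ⟨⟨φ, h2⟩, (oneSub_birmanSchwinger_apply hKB ⟨φ, h2⟩).trans h1, rfl⟩

theorem nullSpace_oneSub_le_rootLineal (T : E →ₗ.[ℂ] E) :
    nullSpace (oneSub T) ≤ rootLineal (oneSub T) := by
  rintro _ ⟨v, hv, rfl⟩
  have hv' : oneSub T v = 0 := hv
  refine ⟨fun i => if i = 0 then v else 0, rfl, fun i => ?_, 1, rfl⟩
  by_cases hi : i = 0
  · simp [hi, hv']
  · simp [hi]

/-- If `K` acts as the identity on its range, then the root lineal of `1 - K` is its kernel. -/
theorem rootLineal_oneSub_birmanSchwinger_le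
    (hKB : ∀ φ, (boundaryResolv ι j (perturbed ι j A B) Ω z₀ φ, K φ) ∈ B.graph)
    (hKK : ∀ φ, K (K φ) = K φ) :
    rootLineal (oneSub (birmanSchwinger ι j A Ω z₀ B)) ≤
      nullSpace (oneSub (birmanSchwinger ι j A Ω z₀ B)) := by
  rw [nullSpace_oneSub_birmanSchwinger hKB]
  rintro φ ⟨s, rfl, hs, k, hk⟩
  have hs' : ∀ i, (s (i + 1) : E) = s i - K (s i) := fun i =>
    (hs i).symm.trans (oneSub_birmanSchwinger_apply hKB (s i))
  -- Descent along the chain: `K` kills `s (i + 1) = (1 - K) s i`, so if `K` also fixes it, it is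
  -- zero and `s i` is fixed.
  have h1 : ∀ i, (s i : E) = K (s i) → (s 0 : E) = K (s 0) := by
    intro i
    induction i with
    | zero => exact id
    | succ i ih =>
      intro hi
      apply ih
      have h2 : K (s (i + 1)) = 0 := by rw [hs', map_sub, hKK, sub_self]
      rw [h2, hs'] at hi
      exact sub_eq_zero.1 hi
  have h2 := h1 k (by rw [hk]; simp)
  exact sub_eq_zero.2 h2

theorem virtualStates_eq_map_ker [CompleteSpace E] [(𝓝[Ω] z₀).NeBot]
    (h : IsBoundaryResolvent ι j hj A (𝓝[Ω] z₀) B (boundaryResolv ι j (perturbed ι j A B) Ω z₀))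
    (hAF : (transfer j hj A).IsClosable) (hι : Function.Injective ι)
    (hKB : ∀ φ, (boundaryResolv ι j (perturbed ι j A B) Ω z₀ φ, K φ) ∈ B.graph) :
    virtualStates ι j hj A Ω z₀ B =
      (LinearMap.ker ((1 - K : E →L[ℂ] E) : E →ₗ[ℂ] E)).map
        (boundaryResolv ι j (perturbed ι j A B) Ω z₀ : E →ₗ[ℂ] F) := by
  have h1 : ∀ φ, _ ↔ φ = K φ :=
    fun φ => h.mem_graph_iff nhdsWithin_le_nhds hAF hι (hKB φ)
  ext Ψ
  constructor
  · rintro ⟨⟨φ, rfl⟩, h2⟩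
    exact ⟨φ, sub_eq_zero.2 ((h1 φ).1 (mem_nullSpace_subScalar.1 h2)), rfl⟩
  · rintro ⟨φ, hφ, rfl⟩
    exact ⟨⟨φ, rfl⟩, mem_nullSpace_subScalar.2 ((h1 φ).2 (sub_eq_zero.1 hφ))⟩

theorem range_le_range_toFun {G : E →L[ℂ] F} (hKB : ∀ φ, (G φ, K φ) ∈ B.graph) :
    LinearMap.range (K : E →ₗ[ℂ] E) ≤ LinearMap.range B.toFun := by
  rintro _ ⟨φ, rfl⟩
  obtain ⟨v, -, hv⟩ := B.mem_graph_iff.1 (hKB φ)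
  exact ⟨v, hv⟩

theorem ker_one_sub_le_range : LinearMap.ker ((1 - K : E →L[ℂ] E) : E →ₗ[ℂ] E) ≤
    LinearMap.range (K : E →ₗ[ℂ] E) :=
  fun φ hφ => ⟨φ, (sub_eq_zero.1 hφ : φ = K φ).symm⟩

end VirtualStates

end VirtualLevels

/-! ### Assembly of the four assertions. -/

theorem mainTheorem2
    {E X F : Type*}
    [NormedAddCommGroup E] [NormedSpace ℂ E] [CompleteSpace E]
    [NormedAddCommGroup X] [NormedSpace ℂ X] [CompleteSpace X]
    [NormedAddCommGroup F] [NormedSpace ℂ F] [CompleteSpace F]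
    (ι : E →L[ℂ] X) (hι : Function.Injective ι) (hιd : DenseRange ι)
    (j : X →L[ℂ] F) (hj : Function.Injective j) (hjd : DenseRange j)
    (A : X →ₗ.[ℂ] X) (hA : A.IsClosed) (hAd : Dense (A.domain : Set X))
    (hAF : (VirtualLevels.transfer j hj A).IsClosable)
    (Ω : Set ℂ) (hΩo : IsOpen Ω) (hΩc : IsConnected Ω)
    (hΩ : Disjoint Ω (VirtualLevels.spec A))
    (z₀ : ℂ) (hz₀ : z₀ ∈ VirtualLevels.essSpec A ∩ frontier Ω)
    (hQ : (VirtualLevels.regularizing ι j hj A Ω z₀).Nonempty) :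
    -- the space of virtual states does not depend on the choice of the perturbation
    (∀ B₁ ∈ VirtualLevels.regularizing ι j hj A Ω z₀,
      ∀ B₂ ∈ VirtualLevels.regularizing ι j hj A Ω z₀,
        VirtualLevels.virtualStates ι j hj A Ω z₀ B₁ =
          VirtualLevels.virtualStates ι j hj A Ω z₀ B₂) ∧
    -- it contains the eigenvectors of `A` that belong to `E`
    (∀ B ∈ VirtualLevels.regularizing ι j hj A Ω z₀,
      (LinearMap.range (ι : E →ₗ[ℂ] X) ⊓
          VirtualLevels.nullSpace (VirtualLevels.subScalar A z₀)).map (j : X →ₗ[ℂ] F) ≤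
        VirtualLevels.virtualStates ι j hj A Ω z₀ B) ∧
    -- the operator `B̌ (A + B - z₀ I)⁻¹_Ω` is defined on the whole of `E`
    (∀ B ∈ VirtualLevels.regularizing ι j hj A Ω z₀,
      (VirtualLevels.birmanSchwinger ι j A Ω z₀ B).domain = ⊤) ∧
    -- the minimal rank `r` is finite and is the dimension of the space of virtual states
    ∃ r : ℕ,
      IsLeast (VirtualLevels.opRank '' VirtualLevels.regularizing ι j hj A Ω z₀) (r : Cardinal) ∧
      (∀ B ∈ VirtualLevels.regularizing ι j hj A Ω z₀,
        Module.rank ℂ (VirtualLevels.virtualStates ι j hj A Ω z₀ B) = r ∧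
        (r : Cardinal) ≤ Module.rank ℂ (VirtualLevels.rootLineal
          (VirtualLevels.oneSub (VirtualLevels.birmanSchwinger ι j A Ω z₀ B)))) ∧
      (∀ B ∈ VirtualLevels.regularizing ι j hj A Ω z₀, VirtualLevels.opRank B = r →
        VirtualLevels.nullSpace
            (VirtualLevels.oneSub (VirtualLevels.birmanSchwinger ι j A Ω z₀ B)) =
          VirtualLevels.rootLineal
            (VirtualLevels.oneSub (VirtualLevels.birmanSchwinger ι j A Ω z₀ B))) := by
  open VirtualLevels in
  have hne : (𝓝[Ω] z₀).NeBot :=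
    mem_closure_iff_nhdsWithin_neBot.1 (frontier_subset_closure hz₀.2)
  have hl : 𝓝[Ω] z₀ ≤ 𝓝 z₀ := nhdsWithin_le_nhds
  have hB : ∀ B ∈ regularizing ι j hj A Ω z₀, IsBoundaryResolvent ι j hj A (𝓝[Ω] z₀) B
      (boundaryResolv ι j (perturbed ι j A B) Ω z₀) :=
    fun B hB => isBoundaryResolvent_of_mem_regularizing hB
  have hK : ∀ B ∈ regularizing ι j hj A Ω z₀, ∃ K : E →L[ℂ] E, IsCompactOperator K ∧
      ∀ φ, (boundaryResolv ι j (perturbed ι j A B) Ω z₀ φ, K φ) ∈ B.graph :=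
    fun B h => ((hB B h).graphBoundedLimit hl).exists_compact_comp (hB B h).isClosed
      (hB B h).relCompact
  have hVS : ∀ B₁ ∈ regularizing ι j hj A Ω z₀, ∀ B₂ ∈ regularizing ι j hj A Ω z₀,
      virtualStates ι j hj A Ω z₀ B₁ = virtualStates ι j hj A Ω z₀ B₂ := by
    intro B₁ h₁ B₂ h₂
    rw [virtualStates, virtualStates,
      le_antisymm ((hB B₂ h₂).range_le (hB B₁ h₁) hl) ((hB B₁ h₁).range_le (hB B₂ h₂) hl)]
  -- the dimension of the space of virtual states, computed with any perturbation
  have hrank : ∀ B ∈ regularizing ι j hj A Ω z₀, ∀ K : E →L[ℂ] E, IsCompactOperator K →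
      (∀ φ, (boundaryResolv ι j (perturbed ι j A B) Ω z₀ φ, K φ) ∈ B.graph) →
      Module.rank ℂ (virtualStates ι j hj A Ω z₀ B) =
        (Module.finrank ℂ (LinearMap.ker ((1 - K : E →L[ℂ] E) : E →ₗ[ℂ] E)) : ℕ) := by
    intro B h K hKc hKB
    have hfin := finiteDimensional_ker_one_sub hKc
    have e := Submodule.equivMapOfInjective
      (boundaryResolv ι j (perturbed ι j A B) Ω z₀ : E →ₗ[ℂ] F)
      ((hB B h).injective hl hAF hι) (LinearMap.ker ((1 - K : E →L[ℂ] E) : E →ₗ[ℂ] E))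
    rw [virtualStates_eq_map_ker (hB B h) hAF hι hKB, e.finrank_eq]
    have : FiniteDimensional ℂ _ := e.finiteDimensional
    exact (Module.finrank_eq_rank ℂ _).symm
  obtain ⟨B₀, hB₀⟩ := hQ
  obtain ⟨K₀, hK₀c, hK₀⟩ := hK B₀ hB₀
  set r := Module.finrank ℂ (LinearMap.ker ((1 - K₀ : E →L[ℂ] E) : E →ₗ[ℂ] E)) with hr
  have hkr : ∀ B ∈ regularizing ι j hj A Ω z₀, ∀ K : E →L[ℂ] E, IsCompactOperator K →
      (∀ φ, (boundaryResolv ι j (perturbed ι j A B) Ω z₀ φ, K φ) ∈ B.graph) →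
      Module.finrank ℂ (LinearMap.ker ((1 - K : E →L[ℂ] E) : E →ₗ[ℂ] E)) = r := by
    intro B h K hKc hKB
    have h1 := hrank B h K hKc hKB
    rw [hVS B h B₀ hB₀, hrank B₀ hB₀ K₀ hK₀c hK₀] at h1
    exact_mod_cast h1.symm
  have hle : ∀ B ∈ regularizing ι j hj A Ω z₀, (r : Cardinal) ≤ opRank B := by
    intro B h
    obtain ⟨K, hKc, hKB⟩ := hK B h
    have hfin := finiteDimensional_ker_one_sub hKc
    rw [← hkr B h K hKc hKB, Module.finrank_eq_rank]
    exact Submodule.rank_mono (ker_one_sub_le_range.trans (range_le_range_toFun hKB))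
  refine ⟨hVS, ?_, ?_, r, ⟨?_, ?_⟩, ?_, ?_⟩
  · rintro B h _ ⟨_, ⟨⟨ψ, rfl⟩, hψ⟩, rfl⟩
    have h1 : (ι ψ, z₀ • ι ψ) ∈ A.graph := mem_nullSpace_subScalar.1 hψ
    have h2 := mem_graph_hat (hj := hj) h1
    obtain ⟨k, hk⟩ := (hB B h).relCompact.exists_mem_graph h2
    rw [map_smul] at h2
    exact ⟨⟨k, (hB B h).apply_eq_of_eigenvector hl h1 hk⟩, mem_nullSpace_subScalar.2 h2⟩
  · intro B h
    obtain ⟨K, -, hKB⟩ := hK B h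
    exact birmanSchwinger_domain_eq_top hKB
  · obtain ⟨B, h, hBr⟩ := exists_finiteRank_mem_regularizing hΩo hΩc.isPreconnected hΩ
      (hB B₀ hB₀) ((hB B₀ hB₀).injective hl hAF hι) hK₀c hK₀
    exact ⟨B, h, le_antisymm hBr (hle B h)⟩
  · rintro _ ⟨B, h, rfl⟩
    exact hle B h
  · intro B h
    obtain ⟨K, hKc, hKB⟩ := hK B h
    have hfin := finiteDimensional_ker_one_sub hKc
    refine ⟨by rw [hrank B h K hKc hKB, hkr B h K hKc hKB], ?_⟩
    rw [← hkr B h K hKc hKB, Module.finrank_eq_rank, ← nullSpace_oneSub_birmanSchwinger hKB]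
    exact Submodule.rank_mono (nullSpace_oneSub_le_rootLineal _)
  · intro B h hBr
    obtain ⟨K, hKc, hKB⟩ := hK B h
    refine le_antisymm (nullSpace_oneSub_le_rootLineal _)
      (rootLineal_oneSub_birmanSchwinger_le hKB ?_)
    have hfr : Module.Finite ℂ (LinearMap.range B.toFun) :=
      Module.rank_lt_aleph0_iff.1 (hBr.trans_lt Cardinal.natCast_lt_aleph0)
    have h1 : Module.finrank ℂ (LinearMap.range B.toFun) = r :=
      Module.finrank_eq_of_rank_eq hBr
    -- At minimal rank the chain `ker (1 - K) ⊆ range K ⊆ range B̌` collapses by dimension, so `K`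
    -- fixes its own range.
    have h2 : LinearMap.ker ((1 - K : E →L[ℂ] E) : E →ₗ[ℂ] E) = LinearMap.range B.toFun :=
      Submodule.eq_of_le_of_finrank_eq
        (ker_one_sub_le_range.trans (range_le_range_toFun hKB))
        ((hkr B h K hKc hKB).trans h1.symm)
    intro φ
    have h3 : K φ ∈ LinearMap.ker ((1 - K : E →L[ℂ] E) : E →ₗ[ℂ] E) := by
      rw [h2]
      exact range_le_range_toFun hKB ⟨φ, rfl⟩
    exact (sub_eq_zero.1 h3 : K φ = K (K φ)).symm
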